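/- Let $d\in\mathbb N$, let $I=[0,1]^d$ with Lebesgue measure $\lambda_0$, and let $V=L^2(I;\mathbb R^d)$, whose dual is identified with $V$ by the Riesz theorem. Let $\Lambda=\{z\in V: z(i)\in\mathbb Z^d \text{ for a.e. } i\in I\}$ and $Y=\{y\in V:\int_I y\,d\lambda_0=0\}$, and for $x\in V$ let $Mx=\left(\int_I x\,d\lambda_0\right)\chi_I\in V$ be the constant function equal to the mean of $x$. Let $\mathcal G$ be the set of bijections $g:I\to I$ such that $g$ and $g^{-1}$ are Borel measurable and preserve $\lambda_0$. Let $H:V\times V\to\mathbb R$ satisfy, for all $x,p\in V$, $z\in\Lambda$, $g\in\mathcal G$: (H1) $H(x+z,p)=H(x,p)$; (H2) $H(x\circ g,p\circ g)=H(x,p)$; (H3) $H$ is Lipschitz on $V\times B(0,R)$ for every $R>0$; (H4) $\inf_{x\in V}H(x,p)\to+\infty$ as $\|p\|\to\infty$. Let $u_0:V\to\mathbb R$ satisfy (I1) $u_0(x)=u_0(Mx)$ for all $x\in V$, and (I2) $u_0\in C^1_b(V)$, that is, $u_0$ is continuously Fréchet differentiable, and $u_0$ and $Du_0$ are bounded.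 For $\varepsilon>0$ consider the Cauchy problem $$(\mathrm{CP})_\varepsilon\qquad u_t+H\!\left(\tfrac{x}{\varepsilon},Du\right)=0\ \text{ in }V\times(0,\infty),\qquad u(x,0)=u_0(x)\ \text{ on }V.$$ A viscosity solution of $(\mathrm{CP})_\varepsilon$ is a continuous function $u:V\times[0,\infty)\to\mathbb R$, bounded on $V\times[0,T]$ for every $T>0$, with $u(\cdot,0)=u_0$, such that for every $\varphi\in C^1(V\times(0,\infty))$ and $(x_0,t_0)\in V\times(0,\infty)$: if $u-\varphi$ has a local maximum at $(x_0,t_0)$, then $\varphi_t(x_0,t_0)+H(x_0/\varepsilon,D\varphi(x_0,t_0))\le0$; and if $u-\varphi$ has a local minimum at $(x_0,t_0)$, then $\varphi_t(x_0,t_0)+H(x_0/\varepsilon,D\varphi(x_0,t_0))\ge0$. Then the following hold. 1. For every $\varepsilon>0$, the viscosity solution $u^\varepsilon$ of $(\mathrm{CP})_\varepsilon$ satisfies $$u^\varepsilon(x+\varepsilon z,t)=u^\varepsilon(x,t)\qquad\text{for all } z\in\Lambda\cap Y,\ (x,t)\in V\times[0,\infty).$$ 2. There is a constant $C>0$, independent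 of $\varepsilon$, such that for every $\varepsilon>0$ $$|u^\varepsilon(x,t)-u^\varepsilon(Mx,t)|\le C\varepsilon\qquad\text{for all }(x,t)\in V\times[0,\infty).$$ 3. Every sequence $\varepsilon_n\to0^+$ has a subsequence along which $u^{\varepsilon_n}$ converges, uniformly on bounded subsets of $V\times[0,\infty)$, to a continuous function $u:V\times[0,\infty)\to\mathbb R$ which depends only on $(Mx,t)$, that is, $u(x,t)=u(Mx,t)$ for all $(x,t)\in V\times[0,\infty)$. -/

import Mathlib

open MeasureTheory Set Filter Topology

noncomputable section

namespace HJHom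

/-- The label space `I = [0,1]^d`; its `volume` is Lebesgue measure `λ₀`, a probability measure. -/
abbrev Label (d : ℕ) : Type := Fin d → unitInterval

/-- The Hilbert space `V = L²(I; ℝ^d)` of configurations. -/
abbrev Config (d : ℕ) : Type :=
  Lp (EuclideanSpace ℝ (Fin d)) 2 (volume : Measure (Label d))

/-- `Λ = L²(I; ℤ^d)`: the configurations with values in `ℤ^d` almost everywhere. -/
def latticeConfigs (d : ℕ) : Set (Config d) :=
  {z | ∀ᵐ i : Label d, ∀ k : Fin d, ∃ n : ℤ, z i k = (n : ℝ)}

/-- `Y`: the configurations with mean zero. -/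
def meanZero (d : ℕ) : Set (Config d) :=
  {y | ∫ i : Label d, y i = 0}

/-- `M x = (∫_I x dλ₀) χ_I`, the constant configuration equal to the mean of `x`. -/
def meanConfig {d : ℕ} (x : Config d) : Config d :=
  Lp.const 2 (volume : Measure (Label d)) (∫ i : Label d, x i)

/-- `x ∘ g` for a measure-preserving Borel bijection `g` of `I`. -/
def rearrange {d : ℕ} (g : Label d ≃ᵐ Label d) (hg : MeasurePreserving g volume volume)
    (x : Config d) : Config d :=
  Lp.compMeasurePreserving g hg x

/-- The structural conditions on the Hamiltonian `H : V × V → ℝ`, where `V* = V` by Riesz.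
The inverse of a measure-preserving measurable bijection is automatically measure preserving. -/
structure IsAdmissibleHamiltonian {d : ℕ} (H : Config d → Config d → ℝ) : Prop where
  /-- periodicity -/
  periodic : ∀ x p : Config d, ∀ z ∈ latticeConfigs d, H (x + z) p = H x p
  /-- rearrangement invariance -/
  rearrangement : ∀ (g : Label d ≃ᵐ Label d) (hg : MeasurePreserving g volume volume)
    (x p : Config d), H (rearrange g hg x) (rearrange g hg p) = H x p
  /-- `H` is Lipschitz on `V × B(0,R)` for every `R > 0` -/
  lipschitz : ∀ R : ℝ, 0 < R → ∃ K : NNReal,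
    LipschitzOnWith K (fun q : Config d × Config d => H q.1 q.2) (univ ×ˢ Metric.ball 0 R)
  /-- `inf_x H(x,p) → +∞` as `‖p‖ → ∞` -/
  coercive : ∀ A : ℝ, ∃ R : ℝ, ∀ p : Config d, R ≤ ‖p‖ → ∀ x : Config d, A ≤ H x p

/-- The conditions on the initial datum: it depends only on the mean, and it is in `C_b^1(V)`
(continuously Fréchet differentiable, bounded, with bounded derivative). -/
structure IsAdmissibleInitialDatum {d : ℕ} (u₀ : Config d → ℝ) : Prop where
  mean : ∀ x : Config d, u₀ x = u₀ (meanConfig x)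
  contDiff : ContDiff ℝ 1 u₀
  bounded : ∃ A : ℝ, ∀ x : Config d, |u₀ x| ≤ A
  bounded_fderiv : ∃ A : ℝ, ∀ x : Config d, ‖fderiv ℝ u₀ x‖ ≤ A

/-- `u` is a viscosity subsolution of `u_t + F(x, Du) = 0` in `V × (0,∞)`. The gradient of the
test function is its Riesz representative in `V`. -/
def IsViscositySubsolution {d : ℕ} (F : Config d → Config d → ℝ) (u : Config d → ℝ → ℝ) :
    Prop :=
  ∀ φ : Config d → ℝ → ℝ,
    ContDiffOn ℝ 1 (fun q : Config d × ℝ => φ q.1 q.2) (univ ×ˢ Ioi 0) →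
    ∀ (x₀ : Config d) (t₀ : ℝ), 0 < t₀ →
      IsLocalMax (fun q : Config d × ℝ => u q.1 q.2 - φ q.1 q.2) (x₀, t₀) →
        deriv (fun t => φ x₀ t) t₀ + F x₀ (gradient (fun x => φ x t₀) x₀) ≤ 0

/-- `u` is a viscosity supersolution of `u_t + F(x, Du) = 0` in `V × (0,∞)`. -/
def IsViscositySupersolution {d : ℕ} (F : Config d → Config d → ℝ) (u : Config d → ℝ → ℝ) :
    Prop :=
  ∀ φ : Config d → ℝ → ℝ,
    ContDiffOn ℝ 1 (fun q : Config d × ℝ => φ q.1 q.2) (univ ×ˢ Ioi 0) →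
    ∀ (x₀ : Config d) (t₀ : ℝ), 0 < t₀ →
      IsLocalMin (fun q : Config d × ℝ => u q.1 q.2 - φ q.1 q.2) (x₀, t₀) →
        0 ≤ deriv (fun t => φ x₀ t) t₀ + F x₀ (gradient (fun x => φ x t₀) x₀)

/-- `u : V × [0,∞) → ℝ` is the viscosity solution of the Cauchy problem
`u_t + H(x/ε, Du) = 0` in `V × (0,∞)`, `u(·,0) = u₀`, in the class of continuous functions that
are bounded on `V × [0,T]` for every `T`. Values at negative times are irrelevant. -/
structure IsViscositySolution {d : ℕ} (H : Config d → Config d → ℝ) (u₀ : Config d → ℝ)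
    (ε : ℝ) (u : Config d → ℝ → ℝ) : Prop where
  continuousOn : ContinuousOn (fun q : Config d × ℝ => u q.1 q.2) (univ ×ˢ Ici 0)
  bounded : ∀ T : ℝ, ∃ A : ℝ, ∀ (x : Config d) (t : ℝ), 0 ≤ t → t ≤ T → |u x t| ≤ A
  initial : ∀ x : Config d, u x 0 = u₀ x
  subsolution : IsViscositySubsolution (fun x p => H (ε⁻¹ • x) p) u
  supersolution : IsViscositySupersolution (fun x p => H (ε⁻¹ • x) p) u

end HJHom

end

namespace HJHom

/-! ### Smooth perturbed maxima in Hilbert spaces -/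

section Variational

variable {E : Type*} [NormedAddCommGroup E] [InnerProductSpace ℝ E]

/-! The configuration space is infinite-dimensional, but the solutions see little more than the
mean. The vectors of `Λ ∩ Y` form a `√d`-net in the mean-zero space `Y`, because rounding a
configuration can be arranged to preserve its mean (`exists_latticeConfig_near`). A translate of
`u^ε` by `εz` with `z ∈ Λ ∩ Y` solves the same equation with the same initial datum, so comparison
gives periodicity. If moreover `u^ε` is `L`-Lipschitz in `x` uniformly in `ε`, moving from `x` to
`Mx` costs at most `L√d ε`. On constant configurations the problem lives in `ℝ^d × [0,∞)`, where
Arzelà–Ascoli applies, and the oscillation bound carries the limit back to `V`.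

The uniform estimates come in three steps. Periodicity bounds `H` on bounded momenta, so `u₀ ± Ct`
are barriers (`SeparatedSubsolution.le_initial_add`). Comparing `u` with its time shifts turns this
initial speed into a Lipschitz bound in time. Coercivity then bounds the spatial slope
(`SeparatedSubsolution.lipschitz_space`). Neither constant involves `ε`, since boundedness and
coercivity of `H` are uniform in `x`.

Each step maximizes a functional on a space without local compactness, where maxima may fail to
exist. The Borwein–Preiss principle supplies exact maxima after a small quadratic perturbation,
which stays within the class of `C^1` test functions. -/

theorem exists_almost_max {X : Type*} {S : Set X} {g : X → ℝ} (hg : BddAbove (g '' S)) {q : X}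
    (hq : q ∈ S) {η : ℝ} (hη : 0 < η) :
    ∃ q' ∈ S, g q ≤ g q' ∧ ∀ y ∈ S, g y ≤ g q' + η := by
  obtain ⟨_, ⟨y, hy, rfl⟩, hlt⟩ :=
    exists_lt_of_lt_csSup (⟨g q, q, hq, rfl⟩ : (g '' S).Nonempty) (sub_lt_self (sSup (g '' S)) hη)
  have hle : ∀ z ∈ S, g z ≤ sSup (g '' S) := fun z hz => le_csSup hg ⟨z, hz, rfl⟩
  by_cases h : g q ≤ g y
  · exact ⟨y, hy, h, fun z hz => by linarith [hle z hz]⟩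
  · exact ⟨q, hq, le_rfl, fun z hz => by linarith [hle z hz]⟩

/-- A weighted sum of squared distances to the points of a bounded sequence is a single squared
distance, up to a constant. -/
theorem hasSum_weighted_sq_dist [CompleteSpace E] {w : ℕ → ℝ} (hw0 : ∀ n, 0 ≤ w n)
    (hw : HasSum w (1 / 2)) {q : ℕ → E} {B : ℝ} (hB : ∀ n, ‖q n‖ ≤ B) :
    ∃ c : ℝ, ∀ x : E, HasSum (fun n => w n * ‖x - q n‖ ^ 2)
      (1 / 2 * ‖x - (2 : ℝ) • ∑' n, w n • q n‖ ^ 2 + c) := by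
  have h1 : Summable fun n => w n • q n := by
    refine Summable.of_norm_bounded (hw.summable.mul_right B) fun n => ?_
    rw [norm_smul, Real.norm_of_nonneg (hw0 n)]
    exact mul_le_mul_of_nonneg_left (hB n) (hw0 n)
  have h2 : Summable fun n => w n * ‖q n‖ ^ 2 := by
    refine Summable.of_norm_bounded (hw.summable.mul_right (B ^ 2)) fun n => ?_
    rw [norm_mul, Real.norm_of_nonneg (hw0 n), norm_pow, norm_norm]
    exact mul_le_mul_of_nonneg_left (pow_le_pow_left₀ (norm_nonneg _) (hB n) 2) (hw0 n)
  set m := ∑' n, w n • q n with hm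
  refine ⟨(∑' n, w n * ‖q n‖ ^ 2) - 2 * ‖m‖ ^ 2, fun x => ?_⟩
  have h3 : HasSum (fun n => w n * inner ℝ x (q n)) (inner ℝ x m) := by
    have := h1.hasSum.mapL (innerSL ℝ x)
    simpa [inner_smul_right] using this
  have h4 := ((hw.mul_right (‖x‖ ^ 2)).sub (h3.mul_left 2)).add h2.hasSum
  have h5 : (fun n => w n * ‖x - q n‖ ^ 2) =
      fun n => w n * ‖x‖ ^ 2 - 2 * (w n * inner ℝ x (q n)) + w n * ‖q n‖ ^ 2 := by
    funext n
    rw [norm_sub_sq_real]; ring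
  have h6 : 1 / 2 * ‖x - (2 : ℝ) • m‖ ^ 2 + ((∑' n, w n * ‖q n‖ ^ 2) - 2 * ‖m‖ ^ 2) =
      1 / 2 * ‖x‖ ^ 2 - 2 * inner ℝ x m + ∑' n, w n * ‖q n‖ ^ 2 := by
    rw [norm_sub_sq_real, inner_smul_right, norm_smul, Real.norm_ofNat]
    ring
  rw [h5, h6]
  exact h4

/-- The smooth variational principle of Borwein and Preiss in a Hilbert space. -/
theorem smooth_variational_principle [CompleteSpace E] {S : Set E} (hS : IsClosed S)
    (hne : S.Nonempty) {f : E → ℝ} (hf : ContinuousOn f S) (hb : BddAbove (f '' S)) {r : ℝ}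
    (hr : 0 < r) :
    ∃ b : E, ∃ q ∈ S, ‖q - b‖ ≤ r ∧
      (∀ y ∈ S, f y - 1 / 2 * ‖y - b‖ ^ 2 ≤ f q - 1 / 2 * ‖q - b‖ ^ 2) ∧
      ∀ y ∈ S, f y ≤ f q + r ^ 2 := by
  obtain ⟨s, hs⟩ := hne
  -- The weights sum to `1/2`, the coefficient of the final penalty. The tolerance `η n` is the
  -- penalty of weight `w n` at distance `r/2^n`, so almost-maximality will confine later points to
  -- that distance.
  set w : ℕ → ℝ := fun n => (1 / 4) * (1 / 2) ^ n with hw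
  have hwpos : ∀ n, 0 < w n := fun n => by positivity
  have hwsum : HasSum w (1 / 2) := by
    have := hasSum_geometric_two.mul_left (1 / 4 : ℝ)
    norm_num at this ⊢
    simpa [hw] using this
  set η : ℕ → ℝ := fun n => w n * (r * (1 / 2) ^ n) ^ 2 with hη
  have hηpos : ∀ n, 0 < η n := fun n => by positivity
  have hstep : ∀ (g : E → ℝ) (q : E) (e : ℝ), BddAbove (g '' S) → q ∈ S → 0 < e →
      ∃ q', q' ∈ S ∧ g q ≤ g q' ∧ ∀ y ∈ S, g y ≤ g q' + e := fun g q e h1 h2 h3 =>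
    exists_almost_max h1 h2 h3
  choose! nx hnxS hnx1 hnx2 using hstep
  -- The state is the current functional and an almost-maximizer of it. Each step penalizes distance
  -- to that point and selects a new point that is no worse.
  let st : ℕ → (E → ℝ) × E := fun n => Nat.rec (f, nx f s (η 0))
    (fun n p => (fun y => p.1 y - w n * ‖y - p.2‖ ^ 2,
      nx (fun y => p.1 y - w n * ‖y - p.2‖ ^ 2) p.2 (η (n + 1)))) n
  set g : ℕ → E → ℝ := fun n => (st n).1 with hg
  set q : ℕ → E := fun n => (st n).2 with hq
  have hg0 : g 0 = f := rfl
  have hgs : ∀ n y, g (n + 1) y = g n y - w n * ‖y - q n‖ ^ 2 := fun n y => rfl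
  have hq0 : q 0 = nx f s (η 0) := rfl
  have hqs : ∀ n, q (n + 1) = nx (g (n + 1)) (q n) (η (n + 1)) := fun n => rfl
  have hganti1 : ∀ n y, g (n + 1) y ≤ g n y := fun n y => by
    rw [hgs]; have := mul_nonneg (hwpos n).le (sq_nonneg ‖y - q n‖); linarith
  have hganti : ∀ y, Antitone fun n => g n y := fun y => antitone_nat_of_succ_le fun n => hganti1 n y
  have hgb : ∀ n, BddAbove (g n '' S) := fun n => by
    obtain ⟨B, hB⟩ := hb
    refine ⟨B, ?_⟩
    rintro _ ⟨y, hy, rfl⟩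
    exact (hganti y (Nat.zero_le n)).trans (hB ⟨y, hy, rfl⟩)
  have hqS : ∀ n, q n ∈ S := fun n => by
    induction n with
    | zero => exact hnxS _ _ _ hb hs (hηpos 0)
    | succ n ih => exact hnxS _ _ _ (hgb (n + 1)) ih (hηpos (n + 1))
  have hmax : ∀ n, ∀ y ∈ S, g n y ≤ g n (q n) + η n := fun n => by
    cases n with
    | zero => exact hnx2 _ _ _ hb hs (hηpos 0)
    | succ n => exact hnx2 _ _ _ (hgb (n + 1)) (hqS n) (hηpos (n + 1))
  have hself : ∀ n, g (n + 1) (q n) = g n (q n) := fun n => by rw [hgs]; simp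
  have hmono : Monotone fun n => g n (q n) := monotone_nat_of_le_succ fun n => by
    rw [← hself n]
    exact hnx1 _ _ _ (hgb (n + 1)) (hqS n) (hηpos (n + 1))
  -- The penalty added at step `n` vanishes at `q n`, so no value is lost there. Against the
  -- almost-maximality of `q n`, this forces the penalty at every later `q m` below `η n`.
  have hlow : ∀ n m, n ≤ m → g n (q n) ≤ g (n + 1) (q m) := fun n m hnm => by
    rcases hnm.eq_or_lt with rfl | h
    · exact (hself n).ge
    · exact (hmono hnm).trans (hganti _ h)
  have hdist : ∀ n m, n ≤ m → ‖q m - q n‖ ≤ r * (1 / 2) ^ n := fun n m hnm => by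
    have h1 := hlow n m hnm
    rw [hgs] at h1
    have h2 := hmax n _ (hqS m)
    have h3 : w n * ‖q m - q n‖ ^ 2 ≤ w n * (r * (1 / 2) ^ n) ^ 2 := by
      change _ ≤ η n
      linarith
    have h4 := le_of_mul_le_mul_left h3 (hwpos n)
    exact le_of_sq_le_sq h4 (by positivity)
  have hcau : CauchySeq q := by
    refine cauchySeq_of_le_tendsto_0 (fun n => 2 * (r * (1 / 2) ^ n)) (fun n m N hn hm => ?_) ?_
    · rw [dist_eq_norm]
      have := norm_sub_le (q n - q N) (q m - q N)
      rw [sub_sub_sub_cancel_right] at this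
      linarith [hdist N n hn, hdist N m hm]
    · have := (tendsto_pow_atTop_nhds_zero_of_lt_one (r := (1 / 2 : ℝ)) (by norm_num)
        (by norm_num)).const_mul r |>.const_mul 2
      simpa using this
  obtain ⟨p, hp⟩ := cauchySeq_tendsto_of_complete hcau
  have hpS : p ∈ S := hS.mem_of_tendsto hp (Eventually.of_forall hqS)
  have hpd : ∀ n, ‖p - q n‖ ≤ r := fun n => by
    have h1 : Tendsto (fun m => ‖q m - q n‖) atTop (𝓝 ‖p - q n‖) := (hp.sub_const _).norm
    refine (le_of_tendsto h1 (eventually_atTop.2 ⟨n, fun m hm => hdist n m hm⟩)).trans ?_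
    exact mul_le_of_le_one_right hr.le (pow_le_one₀ (by norm_num) (by norm_num))
  have hgc : ∀ n, ContinuousOn (g n) S := fun n => by
    induction n with
    | zero => exact hf
    | succ n ih =>
      have : ContinuousOn (fun y => g n y - w n * ‖y - q n‖ ^ 2) S := by fun_prop
      exact this
  have hlim : ∀ n, g n (q n) ≤ g (n + 1) p := fun n => by
    have h1 : Tendsto (fun m => g (n + 1) (q m)) atTop (𝓝 (g (n + 1) p)) :=
      (hgc (n + 1) p hpS).tendsto.comp
        (tendsto_nhdsWithin_iff.2 ⟨hp, Eventually.of_forall hqS⟩)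
    exact ge_of_tendsto h1 (eventually_atTop.2 ⟨n, fun m hm => hlow n m hm⟩)
  -- The infinitely many penalties collapse to one, centred at the weighted mean of the points `q
  -- n`; the constant `c` does not affect maximality.
  obtain ⟨c, hc⟩ := hasSum_weighted_sq_dist (fun n => (hwpos n).le) hwsum (q := q)
    (B := ‖p‖ + r) (fun n => by
      have := norm_sub_le p (p - q n)
      rw [sub_sub_cancel] at this
      linarith [hpd n])
  set b := (2 : ℝ) • ∑' n, w n • q n with hbdef
  have hgform : ∀ n y, g n y = f y - ∑ i ∈ Finset.range n, w i * ‖y - q i‖ ^ 2 := fun n y => by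
    induction n with
    | zero => simp [hg0]
    | succ n ih => rw [hgs, ih, Finset.sum_range_succ]; ring
  have hglim : ∀ y, Tendsto (fun n => g n y) atTop (𝓝 (f y - (1 / 2 * ‖y - b‖ ^ 2 + c))) :=
    fun y => by
      simp only [hgform]
      exact (hc y).tendsto_sum_nat.const_sub _
  have hηlim : Tendsto η atTop (𝓝 0) := by
    have h1 : Tendsto (fun n : ℕ => ((1 / 2 : ℝ)) ^ n) atTop (𝓝 0) :=
      tendsto_pow_atTop_nhds_zero_of_lt_one (by norm_num) (by norm_num)
    have := (h1.const_mul (1 / 4)).mul ((h1.const_mul r).pow 2)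
    simpa [hη, hw] using this
  refine ⟨b, p, hpS, ?_, fun y hy => ?_, fun y hy => ?_⟩
  · have hs1 : Summable fun n => w n • q n := by
      refine Summable.of_norm_bounded (hwsum.summable.mul_right (‖p‖ + r)) fun n => ?_
      rw [norm_smul, Real.norm_of_nonneg (hwpos n).le]
      refine mul_le_mul_of_nonneg_left ?_ (hwpos n).le
      have := norm_sub_le p (p - q n)
      rw [sub_sub_cancel] at this
      linarith [hpd n]
    have h2 : HasSum (fun n => w n • (p - q n)) ((1 / 2 : ℝ) • p - ∑' n, w n • q n) := by
      simp only [smul_sub]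
      exact (hwsum.smul_const p).sub hs1.hasSum
    have h3 : ‖(1 / 2 : ℝ) • p - ∑' n, w n • q n‖ ≤ 1 / 2 * r := by
      rw [← h2.tsum_eq]
      refine tsum_of_norm_bounded (hwsum.mul_right r) fun n => ?_
      rw [norm_smul, Real.norm_of_nonneg (hwpos n).le]
      exact mul_le_mul_of_nonneg_left (hpd n) (hwpos n).le
    have h4 : p - b = (2 : ℝ) • ((1 / 2 : ℝ) • p - ∑' n, w n • q n) := by
      rw [smul_sub, smul_smul]; norm_num [hbdef]
    rw [h4, norm_smul]
    norm_num
    norm_num at h3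
    linarith
  · have h1 : ∀ n, g n y ≤ g (n + 1) p + η n := fun n => (hmax n y hy).trans (by linarith [hlim n])
    have h2 := le_of_tendsto_of_tendsto' (hglim y)
      (((hglim p).comp (tendsto_add_atTop_nat 1)).add hηlim) h1
    linarith
  · have h1 := hmax 0 y hy
    have h2 := hlim 0
    have h3 := hganti1 0 p
    rw [hg0] at *
    have h4 : η 0 ≤ r ^ 2 := by
      simp only [hη, hw]; nlinarith [sq_nonneg r]
    linarith

end Variational

section VariationalProd

variable {E G : Type*} [NormedAddCommGroup E] [InnerProductSpace ℝ E] [CompleteSpace E]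
  [NormedAddCommGroup G] [InnerProductSpace ℝ G] [CompleteSpace G]

/-- The smooth variational principle on a product of two Hilbert spaces. -/
theorem smooth_variational_principle_prod {S : Set (E × G)} (hS : IsClosed S)
    (hne : S.Nonempty) {f : E × G → ℝ} (hf : ContinuousOn f S) (hb : BddAbove (f '' S)) {r : ℝ}
    (hr : 0 < r) :
    ∃ b : E × G, ∃ q ∈ S, ‖q.1 - b.1‖ ≤ r ∧ ‖q.2 - b.2‖ ≤ r ∧
      (∀ y ∈ S, f y - (1 / 2 * ‖y.1 - b.1‖ ^ 2 + 1 / 2 * ‖y.2 - b.2‖ ^ 2) ≤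
        f q - (1 / 2 * ‖q.1 - b.1‖ ^ 2 + 1 / 2 * ‖q.2 - b.2‖ ^ 2)) ∧
      ∀ y ∈ S, f y ≤ f q + r ^ 2 := by
  have hcont : Continuous (WithLp.ofLp : WithLp 2 (E × G) → E × G) :=
    WithLp.prod_continuous_ofLp 2 E G
  obtain ⟨b, q, hq, h1, h2, h3⟩ := smooth_variational_principle
    (S := (WithLp.ofLp : WithLp 2 (E × G) → E × G) ⁻¹' S) (hS.preimage hcont)
    (by obtain ⟨s, hs⟩ := hne; exact ⟨WithLp.toLp 2 s, hs⟩)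
    (f := fun q => f q.ofLp) (hf.comp hcont.continuousOn (fun _ h => h))
    (hb.mono (by rintro _ ⟨y, hy, rfl⟩; exact ⟨_, hy, rfl⟩)) hr
  have hn : ∀ y : WithLp 2 (E × G), ‖y - b‖ ^ 2 =
      ‖y.ofLp.1 - b.ofLp.1‖ ^ 2 + ‖y.ofLp.2 - b.ofLp.2‖ ^ 2 := fun y => by
    rw [WithLp.prod_norm_sq_eq_of_L2]; rfl
  have hqr : ‖q - b‖ ^ 2 ≤ r ^ 2 := pow_le_pow_left₀ (norm_nonneg _) h1 2
  rw [hn] at hqr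
  refine ⟨b.ofLp, q.ofLp, hq, ?_, ?_, fun y hy => ?_, fun y hy => h3 (WithLp.toLp 2 y) hy⟩
  · exact le_of_sq_le_sq (by linarith [sq_nonneg ‖q.ofLp.2 - b.ofLp.2‖]) hr.le
  · exact le_of_sq_le_sq (by linarith [sq_nonneg ‖q.ofLp.1 - b.ofLp.1‖]) hr.le
  · have := h2 (WithLp.toLp 2 y) hy
    rw [hn, hn] at this
    linarith

end VariationalProd

section BoundedInTime

variable {V : Type*} [NormedAddCommGroup V]

/-- A continuous function on `V × [0,∞)` that is bounded on bounded time intervals. -/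
structure BoundedInTime (u : V → ℝ → ℝ) : Prop where
  continuousOn : ContinuousOn (fun q : V × ℝ => u q.1 q.2) (univ ×ˢ Ici 0)
  bounded : ∀ T : ℝ, ∃ A : ℝ, ∀ (x : V) (t : ℝ), 0 ≤ t → t ≤ T → |u x t| ≤ A

theorem BoundedInTime.continuousOn_cylinder {u : V → ℝ → ℝ} (hu : BoundedInTime u) (T : ℝ) :
    ContinuousOn (fun q : V × ℝ => u q.1 q.2) (univ ×ˢ Icc 0 T) :=
  hu.continuousOn.mono (prod_mono_right Icc_subset_Ici_self)

end BoundedInTime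

theorem contDiff_mul_sq_dist {V : Type*} [NormedAddCommGroup V]
    [InnerProductSpace ℝ V] (m : ℝ) (b : V) : ContDiff ℝ 1 fun y => m * ‖y - b‖ ^ 2 :=
  contDiff_const.mul ((contDiff_id.sub contDiff_const).norm_sq ℝ)

/-! ### Viscosity tests at perturbed maxima and the initial speed -/

section PDE

variable {V : Type*} [NormedAddCommGroup V] [InnerProductSpace ℝ V] [CompleteSpace V]

/-- The smooth variational principle on a space-time cylinder. -/
theorem exists_perturbed_max {f : V → ℝ → ℝ} {T r M : ℝ} (hT : 0 ≤ T) (hr : 0 < r)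
    (hf : ContinuousOn (fun q : V × ℝ => f q.1 q.2) (univ ×ˢ Icc 0 T))
    (hM : ∀ x, ∀ t ∈ Icc 0 T, f x t ≤ M) :
    ∃ (b : V) (c : ℝ) (x : V), ∃ t ∈ Icc 0 T, ‖x - b‖ ≤ r ∧ |t - c| ≤ r ∧
      (∀ y, ∀ s ∈ Icc 0 T, f y s - (1 / 2 * ‖y - b‖ ^ 2 + 1 / 2 * (s - c) ^ 2) ≤
        f x t - (1 / 2 * ‖x - b‖ ^ 2 + 1 / 2 * (t - c) ^ 2)) ∧
      ∀ y, ∀ s ∈ Icc 0 T, f y s ≤ f x t + r ^ 2 := by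
  obtain ⟨⟨b, c⟩, ⟨x, t⟩, hq, h1, h2, h3, h4⟩ := smooth_variational_principle_prod
    (isClosed_univ.prod isClosed_Icc) ⟨((0 : V), (0 : ℝ)), mem_univ _, left_mem_Icc.2 hT⟩ hf
    ⟨M, by rintro _ ⟨⟨y, s⟩, hy, rfl⟩; exact hM y s hy.2⟩ hr
  simp only [Real.norm_eq_abs, sq_abs] at h1 h2 h3
  exact ⟨b, c, x, t, hq.2, h1, h2, fun y s hs => h3 (y, s) ⟨mem_univ _, hs⟩,
    fun y s hs => h4 (y, s) ⟨mem_univ _, hs⟩⟩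

/-- The smooth variational principle on a product of two space-time cylinders. -/
theorem exists_perturbed_max_doubled {f : V → ℝ → V → ℝ → ℝ} {T r M : ℝ} (hT : 0 ≤ T)
    (hr : 0 < r)
    (hf : ContinuousOn (fun q : (V × ℝ) × V × ℝ => f q.1.1 q.1.2 q.2.1 q.2.2)
      ((univ ×ˢ Icc 0 T) ×ˢ (univ ×ˢ Icc 0 T)))
    (hM : ∀ x, ∀ t ∈ Icc 0 T, ∀ y, ∀ s ∈ Icc 0 T, f x t y s ≤ M) :
    ∃ (b : V) (c : ℝ) (b' : V) (c' : ℝ) (x : V), ∃ t ∈ Icc 0 T, ∃ y : V, ∃ s ∈ Icc 0 T,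
      ‖x - b‖ ≤ r ∧ |t - c| ≤ r ∧ ‖y - b'‖ ≤ r ∧ |s - c'| ≤ r ∧
      (∀ x', ∀ t' ∈ Icc 0 T,
        f x' t' y s - (1 / 2 * ‖x' - b‖ ^ 2 + 1 / 2 * (t' - c) ^ 2) ≤
        f x t y s - (1 / 2 * ‖x - b‖ ^ 2 + 1 / 2 * (t - c) ^ 2)) ∧
      (∀ y', ∀ s' ∈ Icc 0 T,
        f x t y' s' - (1 / 2 * ‖y' - b'‖ ^ 2 + 1 / 2 * (s' - c') ^ 2) ≤
        f x t y s - (1 / 2 * ‖y - b'‖ ^ 2 + 1 / 2 * (s - c') ^ 2)) ∧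
      ∀ x', ∀ t' ∈ Icc 0 T, ∀ y', ∀ s' ∈ Icc 0 T, f x' t' y' s' ≤ f x t y s + r ^ 2 := by
  have hcont : Continuous (WithLp.ofLp : WithLp 2 (V × ℝ) → V × ℝ) := WithLp.prod_continuous_ofLp 2 V ℝ
  have hcyl : IsClosed ((univ : Set V) ×ˢ Icc (0 : ℝ) T) := isClosed_univ.prod isClosed_Icc
  have h0 : (WithLp.toLp 2 ((0 : V), (0 : ℝ)) : WithLp 2 (V × ℝ)) ∈
      (WithLp.ofLp : WithLp 2 (V × ℝ) → V × ℝ) ⁻¹' (univ ×ˢ Icc (0 : ℝ) T) := ⟨mem_univ _, left_mem_Icc.2 hT⟩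
  obtain ⟨⟨b, c⟩, ⟨x, y⟩, hq, h1, h2, h3, h4⟩ := smooth_variational_principle_prod
    (S := ((WithLp.ofLp : WithLp 2 (V × ℝ) → V × ℝ) ⁻¹' (univ ×ˢ Icc 0 T)) ×ˢ
      ((WithLp.ofLp : WithLp 2 (V × ℝ) → V × ℝ) ⁻¹' (univ ×ˢ Icc 0 T)))
    (f := fun q => f q.1.ofLp.1 q.1.ofLp.2 q.2.ofLp.1 q.2.ofLp.2)
    ((hcyl.preimage hcont).prod (hcyl.preimage hcont)) ⟨(_, _), h0, h0⟩
    (hf.comp (f := fun q : WithLp 2 (V × ℝ) × WithLp 2 (V × ℝ) =>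
       (q.1.ofLp, q.2.ofLp)) (by fun_prop) (fun q h => h))
    ⟨M, by rintro _ ⟨⟨y, s⟩, hy, rfl⟩; exact hM _ _ hy.1.2 _ _ hy.2.2⟩ hr
  have hn : ∀ z v : WithLp 2 (V × ℝ), ‖z - v‖ ^ 2 =
      ‖z.ofLp.1 - v.ofLp.1‖ ^ 2 + (z.ofLp.2 - v.ofLp.2) ^ 2 := fun z v => by
    rw [WithLp.prod_norm_sq_eq_of_L2, ← sq_abs (z.ofLp.2 - v.ofLp.2), ← Real.norm_eq_abs]; rfl
  have hfst : ∀ z v : WithLp 2 (V × ℝ), ‖z - v‖ ≤ r → ‖z.ofLp.1 - v.ofLp.1‖ ≤ r := fun z v h => by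
    have h' := pow_le_pow_left₀ (norm_nonneg _) h 2
    rw [hn] at h'
    exact le_of_sq_le_sq (by linarith [sq_nonneg (z.ofLp.2 - v.ofLp.2)]) hr.le
  have hsnd : ∀ z v : WithLp 2 (V × ℝ), ‖z - v‖ ≤ r → |z.ofLp.2 - v.ofLp.2| ≤ r := fun z v h => by
    have h' := pow_le_pow_left₀ (norm_nonneg _) h 2
    rw [hn, ← sq_abs (_ - _)] at h'
    exact le_of_sq_le_sq (by linarith [sq_nonneg ‖z.ofLp.1 - v.ofLp.1‖]) hr.le
  refine ⟨b.ofLp.1, b.ofLp.2, c.ofLp.1, c.ofLp.2, x.ofLp.1, x.ofLp.2, hq.1.2, y.ofLp.1,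
    y.ofLp.2, hq.2.2, hfst _ _ h1, hsnd _ _ h1, hfst _ _ h2, hsnd _ _ h2,
    fun x' t' ht' => ?_, fun y' s' hs' => ?_, fun x' t' ht' y' s' hs' =>
      h4 (WithLp.toLp 2 (x', t'), WithLp.toLp 2 (y', s')) ⟨⟨mem_univ _, ht'⟩, mem_univ _, hs'⟩⟩
  · have := h3 (WithLp.toLp 2 (x', t'), y) ⟨⟨mem_univ _, ht'⟩, hq.2⟩
    simp only [hn] at this
    linarith
  · have := h3 (x, WithLp.toLp 2 (y', s')) ⟨hq.1, mem_univ _, hs'⟩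
    simp only [hn] at this
    linarith

/-- Viscosity subsolutions of `u_t + F(x, Du) = 0` for `t > 0`, tested only with separated
functions `a x + c t` that are `C^1` on the whole space. -/
def SeparatedSubsolution (F : V → V → ℝ) (u : V → ℝ → ℝ) : Prop :=
  ∀ (a : V → ℝ) (c : ℝ → ℝ), ContDiff ℝ 1 a → ContDiff ℝ 1 c → ∀ (x₀ : V) (t₀ : ℝ), 0 < t₀ →
    IsLocalMax (fun q : V × ℝ => u q.1 q.2 - (a q.1 + c q.2)) (x₀, t₀) →
      deriv c t₀ + F x₀ (gradient a x₀) ≤ 0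

/-- Since `0 < t₀ < T`, the closed cylinder is a neighbourhood of the point, so a maximum over it is
local. -/
theorem SeparatedSubsolution.of_max {F : V → V → ℝ} {u : V → ℝ → ℝ}
    (hu : SeparatedSubsolution F u) {a : V → ℝ} {c : ℝ → ℝ} (ha : ContDiff ℝ 1 a)
    (hc : ContDiff ℝ 1 c) {x₀ p : V} {t₀ T τ : ℝ} (ht₀ : 0 < t₀) (hT : t₀ < T)
    (hp : HasGradientAt a p x₀) (hτ : HasDerivAt c τ t₀)
    (hmax : ∀ x, ∀ t ∈ Icc 0 T, u x t - (a x + c t) ≤ u x₀ t₀ - (a x₀ + c t₀)) :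
    τ + F x₀ p ≤ 0 := by
  have := hu a c ha hc x₀ t₀ ht₀ ?_
  · rwa [hτ.deriv, hp.gradient] at this
  · have h1 : ∀ᶠ t in 𝓝 t₀, t ∈ Icc 0 T := Icc_mem_nhds ht₀ hT
    have h2 : ∀ᶠ q : V × ℝ in 𝓝 (x₀, t₀), q.2 ∈ Icc 0 T :=
      (continuous_snd.tendsto (x₀, t₀)).eventually h1
    exact h2.mono fun q hq => hmax q.1 q.2 hq

theorem hasGradientAt_mul_sq_dist (m : ℝ) (b x : V) :
    HasGradientAt (fun y => m * ‖y - b‖ ^ 2) ((2 * m) • (x - b)) x := by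
  rw [hasGradientAt_iff_hasFDerivAt]
  have h := (((hasFDerivAt_id x).sub_const b).norm_sq).const_mul m
  refine h.congr_fderiv ?_
  ext v
  simp
  ring

theorem hasDerivAt_mul_sq_sub (m b t : ℝ) :
    HasDerivAt (fun s => m * (s - b) ^ 2) (2 * m * (t - b)) t := by
  have := (((hasDerivAt_id t).sub_const b).pow 2).const_mul m
  refine this.congr_deriv ?_
  simp; ring

/-- This penalty plays two roles: its positive slope makes the viscosity inequality strict, and its
value `σ e^k` at `t₀ + 1` exceeds any prescribed bound for large `k`, which keeps maxima off the
artificial final time. At `t₀` it costs only `σ`. -/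
theorem hasDerivAt_exp_penalty (σ k t₀ t : ℝ) :
    HasDerivAt (fun s => σ * Real.exp (k * (s - t₀))) (σ * k * Real.exp (k * (t - t₀))) t := by
  have := ((((hasDerivAt_id t).sub_const t₀).const_mul k).exp).const_mul σ
  refine this.congr_deriv ?_
  simp; ring

theorem hasGradientAt_fun_add {f g : V → ℝ} {p q x : V} (hf : HasGradientAt f p x)
    (hg : HasGradientAt g q x) : HasGradientAt (fun y => f y + g y) (p + q) x := by
  rw [hasGradientAt_iff_hasFDerivAt] at *
  rw [map_add]
  exact hf.add hg

theorem exists_small {a b : ℝ} (ha : 0 < a) (hb : 0 < b) :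
    ∃ r : ℝ, 0 < r ∧ r ≤ 1 ∧ r < a ∧ r ^ 2 < b := by
  refine ⟨min 1 (min (a / 2) (b / 2)), by positivity, min_le_left _ _, ?_, ?_⟩
  · have := (min_le_right (1 : ℝ) _).trans (min_le_left (a / 2) (b / 2))
    linarith
  · have h1 := (min_le_right (1 : ℝ) _).trans (min_le_right (a / 2) (b / 2))
    have h2 := min_le_left (1 : ℝ) (min (a / 2) (b / 2))
    have h3 : 0 < min 1 (min (a / 2) (b / 2)) := by positivity
    nlinarith

theorem exists_exp_gt {σ : ℝ} (hσ : 0 < σ) (M : ℝ) : ∃ k : ℝ, 0 < k ∧ M < σ * Real.exp k := by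
  refine ⟨|M| / σ + 1, by positivity, ?_⟩
  have h1 := Real.add_one_le_exp (|M| / σ + 1)
  have h2 : σ * (|M| / σ + 2) ≤ σ * Real.exp (|M| / σ + 1) :=
    mul_le_mul_of_nonneg_left (by linarith) hσ.le
  have h3 : σ * (|M| / σ + 2) = |M| + 2 * σ := by field_simp
  linarith [le_abs_self M]

/-- A subsolution with smooth initial values moves upwards with bounded speed. -/
theorem SeparatedSubsolution.le_initial_add {F : V → V → ℝ} {u : V → ℝ → ℝ}
    (hu : SeparatedSubsolution F u) (hub : BoundedInTime u) {g : V → ℝ} (hg : ContDiff ℝ 1 g)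
    {A B C : ℝ} (hB : ∀ x, |g x| ≤ B) (hA : ∀ x, ‖gradient g x‖ ≤ A)
    (hC : ∀ x p, ‖p‖ ≤ A + 1 → -C ≤ F x p) (h0 : ∀ x, u x 0 ≤ g x) (x₀ : V) {t₀ : ℝ}
    (ht₀ : 0 ≤ t₀) : u x₀ t₀ ≤ g x₀ + C * t₀ := by
  by_contra! hcon
  obtain ⟨σ, hσ, hσe⟩ : ∃ σ, 0 < σ ∧ u x₀ t₀ - (g x₀ + C * t₀) = 2 * σ :=
    ⟨(u x₀ t₀ - (g x₀ + C * t₀)) / 2, by linarith, by ring⟩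
  obtain ⟨D, hD⟩ := hub.bounded (t₀ + 1)
  obtain ⟨k, hk, hkM⟩ := exists_exp_gt hσ (D + B + |C| * (t₀ + 1))
  set ψ : ℝ → ℝ := fun s => σ * Real.exp (k * (s - t₀)) with hψ
  have hψpos : ∀ s, 0 < ψ s := fun s => by positivity
  set l := σ * k * Real.exp (k * (0 - t₀)) with hl
  have hlpos : 0 < l := by positivity
  -- The perturbation must not push the gradient beyond `A + 1` (`r ≤ 1`), must not absorb the least
  -- penalty slope `l` (`r < l`), and must leave the maximum positive (`r² < σ`).
  obtain ⟨r, hr, hr1, hrl, hrσ⟩ := exists_small hlpos hσ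
  set f : V → ℝ → ℝ := fun x t => u x t - (g x + (C * t + ψ t)) with hf
  have hbase : ∀ x, ∀ t ∈ Icc 0 (t₀ + 1), u x t - (g x + C * t) ≤ D + B + |C| * (t₀ + 1) :=
    fun x t ht => by
      have h1 := (abs_le.1 (hD x t ht.1 ht.2)).2
      have h2 := (abs_le.1 (hB x)).1
      have h3 : -C * t ≤ |C| * (t₀ + 1) :=
        mul_le_mul (neg_le_abs C) ht.2 ht.1 (abs_nonneg C)
      linarith
  obtain ⟨b, c, x, t, ht, h1, h2, h3, h4⟩ := exists_perturbed_max (f := f)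
    (T := t₀ + 1) (M := D + B + |C| * (t₀ + 1)) (by linarith) hr
    ((hub.continuousOn_cylinder _).sub (by
      have := hg.continuous
      fun_prop))
    (fun x t ht => by
      have := hbase x t ht
      have := hψpos t
      simp only [hf]; linarith)
  have hpos : 0 < f x t := by
    have h5 := h4 x₀ t₀ ⟨ht₀, by linarith⟩
    have h6 : f x₀ t₀ = σ := by
      simp only [hf, hψ, sub_self, mul_zero, Real.exp_zero, mul_one]; linarith
    linarith
  have ht0 : 0 < t := by
    rcases ht.1.eq_or_lt with h | h
    · subst h
      have := h0 x
      have := hψpos 0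
      simp only [hf] at hpos
      linarith
    · exact h
  have htT : t < t₀ + 1 := by
    rcases ht.2.eq_or_lt with h | h
    · have h5 := hbase x t ht
      have h6 : ψ t = σ * Real.exp k := by simp [hψ, h]
      simp only [hf] at hpos
      linarith
    · exact h
  have hgd : HasGradientAt g (gradient g x) x :=
    (hg.differentiable one_ne_zero x).hasGradientAt
  have key := hu.of_max (a := fun y => g y + 1 / 2 * ‖y - b‖ ^ 2)
    (c := fun s => (C * s + ψ s) + 1 / 2 * (s - c) ^ 2)
    (hg.add (contDiff_mul_sq_dist _ _)) (by simp only [hψ]; fun_prop) ht0 htT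
    (hasGradientAt_fun_add hgd (hasGradientAt_mul_sq_dist _ _ _))
    ((((hasDerivAt_id t).const_mul C).add (hasDerivAt_exp_penalty σ k t₀ t)).add
      (hasDerivAt_mul_sq_sub _ _ _))
    (fun y s hs => by
      have := h3 y s hs
      simp only [hf] at this
      linarith)
  have h5 : -C ≤ F x (gradient g x + (2 * (1 / 2 : ℝ)) • (x - b)) := by
    refine hC _ _ ((norm_add_le _ _).trans ?_)
    norm_num
    exact add_le_add (hA x) (h1.trans hr1)
  have h6 : l ≤ σ * k * Real.exp (k * (t - t₀)) := by
    refine mul_le_mul_of_nonneg_left (Real.exp_le_exp.2 ?_) (by positivity)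
    exact mul_le_mul_of_nonneg_left (by linarith) hk.le
  have h7 := (abs_le.1 h2).1
  linarith

end PDE

/-! ### Comparison by doubling variables, and spatial Lipschitz bounds -/

section Comparison

variable {V : Type*} [NormedAddCommGroup V] [InnerProductSpace ℝ V] [CompleteSpace V]

set_option maxHeartbeats 400000 in
/-- Comparison of a subsolution `u` of `u_t + F(x, Du) = 0` with a supersolution `-w`, for a
coercive Hamiltonian that is Lipschitz for bounded momenta. -/
theorem SeparatedSubsolution.comparison {F : V → V → ℝ}
    (hcoer : ∀ A : ℝ, ∃ R : ℝ, ∀ p : V, R ≤ ‖p‖ → ∀ x : V, A ≤ F x p)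
    (hlip : ∀ R : ℝ, ∃ K : ℝ, 0 ≤ K ∧ ∀ x y p q : V, ‖p‖ < R → ‖q‖ < R →
      F y q - F x p ≤ K * (‖x - y‖ + ‖p - q‖))
    {u w : V → ℝ → ℝ} (hu : SeparatedSubsolution F u)
    (hw : SeparatedSubsolution (fun x p => -F x (-p)) w)
    (hub : BoundedInTime u) (hwb : BoundedInTime w) {g : V → ℝ} {L C : ℝ} (hL : 0 ≤ L)
    (hC : 0 ≤ C) (hg : ∀ x y, g x - g y ≤ L * ‖x - y‖)
    (hu0 : ∀ x t, 0 ≤ t → u x t ≤ g x + C * t) (hw0 : ∀ x t, 0 ≤ t → w x t ≤ -g x + C * t)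
    (x₀ : V) {t₀ : ℝ} (ht₀ : 0 ≤ t₀) : u x₀ t₀ + w x₀ t₀ ≤ 0 := by
  by_contra! hcon
  obtain ⟨σ, hσ, hσe⟩ : ∃ σ, 0 < σ ∧ u x₀ t₀ + w x₀ t₀ = 4 * σ :=
    ⟨(u x₀ t₀ + w x₀ t₀) / 4, by linarith, by ring⟩
  obtain ⟨D, hDpos, hDu, hDw⟩ : ∃ D : ℝ, 0 < D ∧
      (∀ x, ∀ t ∈ Icc 0 (t₀ + 1), u x t ≤ D) ∧ ∀ x, ∀ t ∈ Icc 0 (t₀ + 1), w x t ≤ D := by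
    obtain ⟨D₁, h₁⟩ := hub.bounded (t₀ + 1)
    obtain ⟨D₂, h₂⟩ := hwb.bounded (t₀ + 1)
    refine ⟨|D₁| + |D₂| + 1, by positivity, fun x t ht => ?_, fun x t ht => ?_⟩
    · linarith [(abs_le.1 (h₁ x t ht.1 ht.2)).2, le_abs_self D₁, abs_nonneg D₂]
    · linarith [(abs_le.1 (h₂ x t ht.1 ht.2)).2, le_abs_self D₂, abs_nonneg D₁]
  obtain ⟨k, hk, hkM⟩ := exists_exp_gt hσ (2 * D)
  set ψ : ℝ → ℝ := fun s => σ * Real.exp (k * (s - t₀)) with hψ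
  have hψpos : ∀ s, 0 < ψ s := fun s => by positivity
  set l := σ * k * Real.exp (k * (0 - t₀)) with hl
  have hlpos : 0 < l := by positivity
  have hlle : ∀ t, 0 ≤ t → l ≤ σ * k * Real.exp (k * (t - t₀)) := fun t ht => by
    refine mul_le_mul_of_nonneg_left (Real.exp_le_exp.2 ?_) (by positivity)
    exact mul_le_mul_of_nonneg_left (by linarith) hk.le
  -- the scale of the time penalty, which bounds the momentum through coercivity
  obtain ⟨θ, hθ, hθC⟩ : ∃ θ : ℝ, 0 < θ ∧ C * θ ≤ σ / 4 :=
    ⟨σ / (4 * (C + 1)), by positivity, by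
      rw [← mul_div_assoc, div_le_div_iff₀ (by positivity) (by norm_num)]; nlinarith⟩
  -- As `u + w ≤ 2D`, positivity of the doubled functional gives `m(t - s)² ≤ 2D = mθ²`, hence `|t -
  -- s| ≤ θ`. The same device with `n` and `κ` controls `‖x - y‖`.
  set m := 2 * D / θ ^ 2 with hm
  have hmpos : 0 < m := by positivity
  have hmθ : m * θ ^ 2 = 2 * D := by rw [hm]; field_simp
  obtain ⟨R, hR⟩ := hcoer (2 * m * θ + 2)
  obtain ⟨K, hK, hKlip⟩ := hlip (R + 2)
  -- The order of choices avoids circularity: `R` comes from coercivity and the time penalty alone,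
  -- `K` from `R`, and only then `κ` and the space penalty `n`. The momentum bound therefore does
  -- not grow with `n`.
  obtain ⟨κ, hκ, hκL, hκK⟩ : ∃ κ : ℝ, 0 < κ ∧ L * κ ≤ σ / 4 ∧ K * κ ≤ l / 4 := by
    refine ⟨min (σ / (4 * (L + 1))) (l / (4 * (K + 1))), by positivity, ?_, ?_⟩
    · refine (mul_le_mul_of_nonneg_left (min_le_left _ _) hL).trans ?_
      rw [← mul_div_assoc, div_le_div_iff₀ (by positivity) (by norm_num)]; nlinarith
    · refine (mul_le_mul_of_nonneg_left (min_le_right _ _) hK).trans ?_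
      rw [← mul_div_assoc, div_le_div_iff₀ (by positivity) (by norm_num)]; nlinarith
  set n := 2 * D / κ ^ 2 with hn
  have hnpos : 0 < n := by positivity
  have hnκ : n * κ ^ 2 = 2 * D := by rw [hn]; field_simp
  obtain ⟨r, hr, hr1, hrl, hrσ⟩ :=
    exists_small (show 0 < l / (2 * (K + 1)) by positivity) hσ
  rw [lt_div_iff₀ (by positivity)] at hrl
  set f : V → ℝ → V → ℝ → ℝ := fun x t y s =>
    u x t + w y s - (n * ‖x - y‖ ^ 2 + m * (t - s) ^ 2 + ψ t + ψ s) with hf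
  obtain ⟨b, c, b', c', x, t, ht, y, s, hs, h1, h2, h3, h4, h5, h6, h7⟩ :=
    exists_perturbed_max_doubled (f := f) (T := t₀ + 1) (M := 2 * D) (by linarith) hr
    (by
      have e1 : ContinuousOn (fun q : (V × ℝ) × V × ℝ => u q.1.1 q.1.2)
          ((univ ×ˢ Icc 0 (t₀ + 1)) ×ˢ (univ ×ˢ Icc 0 (t₀ + 1))) :=
        (hub.continuousOn_cylinder (t₀ + 1)).comp continuousOn_fst fun q hq => hq.1
      have e2 : ContinuousOn (fun q : (V × ℝ) × V × ℝ => w q.2.1 q.2.2)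
          ((univ ×ˢ Icc 0 (t₀ + 1)) ×ˢ (univ ×ˢ Icc 0 (t₀ + 1))) :=
        (hwb.continuousOn_cylinder (t₀ + 1)).comp continuousOn_snd fun q hq => hq.2
      exact (e1.add e2).sub (by fun_prop))
    (fun x t ht y s hs => by
      have := hDu x t ht
      have := hDw y s hs
      have := hψpos t
      have := hψpos s
      have : 0 ≤ n * ‖x - y‖ ^ 2 := by positivity
      have : 0 ≤ m * (t - s) ^ 2 := by positivity
      simp only [hf]; linarith)
  have hfσ : σ < f x t y s := by
    have e1 := h7 x₀ t₀ ⟨ht₀, by linarith⟩ x₀ t₀ ⟨ht₀, by linarith⟩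
    have e2 : f x₀ t₀ x₀ t₀ = 2 * σ := by
      simp only [hf, hψ, sub_self, mul_zero, Real.exp_zero, mul_one, norm_zero]
      linarith
    linarith
  have hu1 := hDu x t ht
  have hw1 := hDw y s hs
  have hψt := hψpos t
  have hψs := hψpos s
  have hnn : 0 ≤ n * ‖x - y‖ ^ 2 := by positivity
  have hmm : 0 ≤ m * (t - s) ^ 2 := by positivity
  have hfv : f x t y s =
    u x t + w y s - (n * ‖x - y‖ ^ 2 + m * (t - s) ^ 2 + ψ t + ψ s) := rfl
  have hxy : ‖x - y‖ ≤ κ := by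
    refine le_of_sq_le_sq (le_of_mul_le_mul_left ?_ hnpos) hκ.le
    linarith
  have hts : |t - s| ≤ θ := by
    refine le_of_sq_le_sq (le_of_mul_le_mul_left ?_ hmpos) hθ.le
    rw [sq_abs]; linarith
  have htT : t < t₀ + 1 := by
    rcases ht.2.eq_or_lt with h | h
    · have e : ψ t = σ * Real.exp k := by simp [hψ, h]
      linarith
    · exact h
  have hsT : s < t₀ + 1 := by
    rcases hs.2.eq_or_lt with h | h
    · have e : ψ s = σ * Real.exp k := by simp [hψ, h]
      linarith
    · exact h
  -- The inequality `t + s ≤ |t - s|` holds when either time is zero. It would bound `u + w` by `Lκ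
  -- + Cθ ≤ σ/2`, below the value `σ` already exceeded.
  have hinit : ¬ t + s ≤ |t - s| := fun h => by
    have e1 := hu0 x t ht.1
    have e2 := hw0 y s hs.1
    have e3 := (hg x y).trans (mul_le_mul_of_nonneg_left hxy hL)
    have e4 := mul_le_mul_of_nonneg_left (h.trans hts) hC
    linarith
  have ht0 : 0 < t := by
    rcases ht.1.eq_or_lt with h | h
    · subst h
      exact absurd (by rw [zero_sub, abs_neg, zero_add]; exact le_abs_self s) hinit
    · exact h
  have hs0 : 0 < s := by
    rcases hs.1.eq_or_lt with h | h
    · subst h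
      exact absurd (by rw [sub_zero, add_zero]; exact le_abs_self t) hinit
    · exact h
  set p := (2 * n) • (x - y) with hp
  have key1 := hu.of_max (x₀ := x) (a := fun z => n * ‖z - y‖ ^ 2 + 1 / 2 * ‖z - b‖ ^ 2)
    (c := fun z => (m * (z - s) ^ 2 + ψ z) + 1 / 2 * (z - c) ^ 2)
    ((contDiff_mul_sq_dist _ _).add (contDiff_mul_sq_dist _ _)) (by simp only [hψ]; fun_prop)
    ht0 htT
    (hasGradientAt_fun_add (hasGradientAt_mul_sq_dist _ _ _) (hasGradientAt_mul_sq_dist _ _ _))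
    (((hasDerivAt_mul_sq_sub _ _ _).add (hasDerivAt_exp_penalty σ k t₀ t)).add
      (hasDerivAt_mul_sq_sub _ _ _))
    (fun x' t' ht' => by
      have := h5 x' t' ht'
      simp only [hf] at this
      linarith)
  have key2 := hw.of_max (x₀ := y) (a := fun z => n * ‖z - x‖ ^ 2 + 1 / 2 * ‖z - b'‖ ^ 2)
    (c := fun z => (m * (z - t) ^ 2 + ψ z) + 1 / 2 * (z - c') ^ 2)
    ((contDiff_mul_sq_dist _ _).add (contDiff_mul_sq_dist _ _)) (by simp only [hψ]; fun_prop)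
    hs0 hsT
    (hasGradientAt_fun_add (hasGradientAt_mul_sq_dist _ _ _) (hasGradientAt_mul_sq_dist _ _ _))
    (((hasDerivAt_mul_sq_sub _ _ _).add (hasDerivAt_exp_penalty σ k t₀ s)).add
      (hasDerivAt_mul_sq_sub _ _ _))
    (fun y' s' hs' => by
      have := h6 y' s' hs'
      simp only [hf] at this
      rw [norm_sub_rev y' x, norm_sub_rev y x]
      linarith)
  have hp1 : (2 * n) • (x - y) + (2 * (1 / 2 : ℝ)) • (x - b) = p + (x - b) := by
    norm_num [hp]
  have hp2 : -((2 * n) • (y - x) + (2 * (1 / 2 : ℝ)) • (y - b')) = p - (y - b') := by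
    rw [hp, neg_add, ← smul_neg, neg_sub]
    norm_num
    abel
  rw [hp1] at key1
  rw [hp2] at key2
  have hl1 := hlle t ht.1
  have hl2 := hlle s hs.1
  have ht2 := abs_le.1 h2
  have hs4 := abs_le.1 h4
  have hts' := abs_le.1 hts
  have hnorm1 : ‖p + (x - b)‖ < R := by
    by_contra! h
    have e1 := hR _ h x
    have e2 : -(2 * m * θ) ≤ 2 * m * (t - s) := by
      have e3 := mul_le_mul_of_nonneg_left hts'.1 (show 0 ≤ 2 * m by linarith only [hmpos])
      linarith only [e3]
    linarith only [e1, e2, key1, hl1, hlpos, ht2.1, hr1]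
  have hnorm2 : ‖(x - b) + (y - b')‖ ≤ 2 * r := (norm_add_le _ _).trans (by linarith)
  have hnorm3 : ‖p - (y - b')‖ < R + 2 := by
    have e1 : p - (y - b') = (p + (x - b)) - ((x - b) + (y - b')) := by abel
    rw [e1]
    exact (norm_sub_le _ _).trans_lt (by linarith)
  -- Adding the two viscosity inequalities cancels the slopes `2m(t - s)`. What remains is `2l ≤ K(κ
  -- + 2r) + 2r`, whereas `Kκ ≤ l/4` and `2(K + 1)r < l`.
  have e1 := hKlip x y (p + (x - b)) (p - (y - b')) (by linarith) hnorm3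
  have e2 : p + (x - b) - (p - (y - b')) = (x - b) + (y - b') := by abel
  rw [e2] at e1
  have e3 : K * (‖x - y‖ + ‖(x - b) + (y - b')‖) ≤ K * (κ + 2 * r) :=
    mul_le_mul_of_nonneg_left (add_le_add hxy hnorm2) hK
  linarith only [key1, key2, e1, e3, hκK, hrl, hl1, hl2, ht2.1, hs4.1, hlpos]

theorem hasGradientAt_sqrt_sq_dist {γ : ℝ} (hγ : 0 < γ) (m : ℝ) (b x : V) :
    HasGradientAt (fun y => m * √(‖y - b‖ ^ 2 + γ ^ 2))
      ((m / √(‖x - b‖ ^ 2 + γ ^ 2)) • (x - b)) x := by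
  rw [hasGradientAt_iff_hasFDerivAt]
  have h0 : ‖x - b‖ ^ 2 + γ ^ 2 ≠ 0 := by positivity
  have h := (((((hasFDerivAt_id x).sub_const b).norm_sq).add_const (γ ^ 2)).sqrt h0).const_mul m
  refine h.congr_fderiv ?_
  ext v
  simp
  ring

/-- A subsolution for a coercive Hamiltonian that decreases in time with bounded speed is Lipschitz
in space. -/
theorem SeparatedSubsolution.lipschitz_space {F : V → V → ℝ} {u : V → ℝ → ℝ}
    (hu : SeparatedSubsolution F u) (hub : BoundedInTime u) {C R : ℝ} (hR0 : 0 ≤ R)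
    (hR : ∀ p : V, R ≤ ‖p‖ → ∀ x : V, C + 1 ≤ F x p)
    (hmono : ∀ x t h, 0 ≤ t → 0 ≤ h → u x t - C * h ≤ u x (t + h)) (x₀ y₀ : V) {t₀ : ℝ}
    (ht₀ : 0 < t₀) : u x₀ t₀ - u y₀ t₀ ≤ (R + 2) * ‖x₀ - y₀‖ := by
  by_contra! hcon
  obtain ⟨σ, hσ, hσe⟩ : ∃ σ, 0 < σ ∧ u x₀ t₀ - u y₀ t₀ - (R + 2) * ‖x₀ - y₀‖ = 2 * σ :=
    ⟨(u x₀ t₀ - u y₀ t₀ - (R + 2) * ‖x₀ - y₀‖) / 2, by linarith, by ring⟩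
  obtain ⟨D, hDpos, hD⟩ : ∃ D : ℝ, 0 < D ∧ ∀ x, ∀ t ∈ Icc 0 (t₀ + 1), |u x t| ≤ D := by
    obtain ⟨D₁, h₁⟩ := hub.bounded (t₀ + 1)
    exact ⟨|D₁| + 1, by positivity, fun x t ht => (h₁ x t ht.1 ht.2).trans
      (by linarith [le_abs_self D₁])⟩
  obtain ⟨ρ, hρ, hρc⟩ : ∃ ρ > 0, ∀ x t, ‖x - y₀‖ < ρ → |t - t₀| < ρ →
      u x t < u y₀ t₀ + σ / 2 := by
    have hc : ContinuousAt (fun q : V × ℝ => u q.1 q.2) (y₀, t₀) :=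
      hub.continuousOn.continuousAt (prod_mem_nhds univ_mem (Ici_mem_nhds ht₀))
    obtain ⟨ρ, hρ, h⟩ := Metric.continuousAt_iff.1 hc (σ / 2) (by positivity)
    refine ⟨ρ, hρ, fun x t hx ht => ?_⟩
    have h1 := @h (x, t) (by
      rw [Prod.dist_eq, dist_eq_norm, Real.dist_eq]; exact max_lt hx ht)
    rw [Real.dist_eq] at h1
    linarith [(abs_lt.1 h1).2]
  obtain ⟨θ, hθ, hθt, hθ1, hθρ⟩ : ∃ θ : ℝ, 0 < θ ∧ θ < t₀ ∧ θ < 1 ∧ θ < ρ :=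
    ⟨min t₀ (min 1 ρ) / 2, by positivity, by linarith [min_le_left t₀ (min 1 ρ)],
      by linarith [(min_le_right t₀ (min 1 ρ)).trans (min_le_left 1 ρ)],
      by linarith [(min_le_right t₀ (min 1 ρ)).trans (min_le_right 1 ρ)]⟩
  set m := 2 * D / θ ^ 2 with hm
  have hmpos : 0 < m := by positivity
  have hmθ : m * θ ^ 2 = 2 * D := by rw [hm]; field_simp
  -- Here `γ` smooths the distance to `y₀` at its vertex. The bound by `σ` keeps the functional
  -- large at `(x₀, t₀)`; the bound by `ρ` makes the smoothing cost at most one unit of slope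
  -- outside the `ρ`-ball, where the maximum must lie.
  obtain ⟨γ, hγ, hγρ, hγσ⟩ : ∃ γ : ℝ, 0 < γ ∧ (R + 2) * γ ≤ ρ ∧ (R + 2) * γ ≤ σ :=
    ⟨min ρ σ / (R + 2), by positivity, by field_simp; exact min_le_left _ _,
      by field_simp; exact min_le_right _ _⟩
  obtain ⟨r, hr, hr1, -, hrσ⟩ := exists_small one_pos (half_pos hσ)
  set N : V → ℝ := fun x => √(‖x - y₀‖ ^ 2 + γ ^ 2) with hN
  have hNpos : ∀ x, 0 < N x := fun x => Real.sqrt_pos.2 (by positivity)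
  have hNle : ∀ x, N x ≤ ‖x - y₀‖ + γ := fun x => by
    refine Real.sqrt_le_iff.2 ⟨by positivity, ?_⟩
    nlinarith [norm_nonneg (x - y₀)]
  set f : V → ℝ → ℝ := fun x t => u x t - ((R + 2) * N x + m * (t - t₀) ^ 2) with hf
  have hNc : Continuous N := by simp only [hN]; fun_prop
  obtain ⟨b, c, x, t, ht, h1, h2, h3, h4⟩ := exists_perturbed_max (f := f)
    (T := t₀ + 1) (M := D) (by linarith) hr
    ((hub.continuousOn_cylinder _).sub (by fun_prop))
    (fun x t ht => by
      have e1 := (abs_le.1 (hD x t ht)).2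
      have e2 : 0 ≤ (R + 2) * N x := mul_nonneg (by linarith) (hNpos x).le
      have e3 : 0 ≤ m * (t - t₀) ^ 2 := by positivity
      simp only [hf]; linarith)
  have hfx : u y₀ t₀ + σ / 2 < f x t := by
    have e1 := h4 x₀ t₀ ⟨ht₀.le, by linarith⟩
    have e2 : u y₀ t₀ + σ ≤ f x₀ t₀ := by
      have e3 := mul_le_mul_of_nonneg_left (hNle x₀) (show 0 ≤ R + 2 by linarith)
      simp only [hf, sub_self]
      linarith
    linarith
  have hfv : f x t = u x t - ((R + 2) * N x + m * (t - t₀) ^ 2) := rfl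
  have hN0 : 0 ≤ (R + 2) * N x := mul_nonneg (by linarith) (hNpos x).le
  have hm0 : 0 ≤ m * (t - t₀) ^ 2 := by positivity
  have htθ : |t - t₀| ≤ θ := by
    refine le_of_sq_le_sq (le_of_mul_le_mul_left ?_ hmpos) hθ.le
    have e1 := (abs_le.1 (hD x t ht)).2
    have e2 := (abs_le.1 (hD y₀ t₀ ⟨ht₀.le, by linarith⟩)).1
    rw [sq_abs]; linarith
  have htt := abs_le.1 htθ
  have ht0 : 0 < t := by linarith
  have htT : t < t₀ + 1 := by linarith
  have hxρ : ρ ≤ ‖x - y₀‖ := by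
    by_contra! h
    linarith [hρc x t h (htθ.trans_lt hθρ)]
  have key := hu.of_max (x₀ := x) (a := fun z => (R + 2) * N z + 1 / 2 * ‖z - b‖ ^ 2)
    (c := fun z => m * (z - t₀) ^ 2 + 1 / 2 * (z - c) ^ 2)
    ((contDiff_const.mul (((((contDiff_id.sub contDiff_const).norm_sq ℝ)).add
      contDiff_const).sqrt fun z => by positivity)).add (contDiff_mul_sq_dist _ _)) (by fun_prop)
    ht0 htT
    (hasGradientAt_fun_add (hasGradientAt_sqrt_sq_dist hγ _ _ _) (hasGradientAt_mul_sq_dist _ _ _))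
    ((hasDerivAt_mul_sq_sub _ _ _).add (hasDerivAt_mul_sq_sub _ _ _))
    (fun x' t' ht' => by
      have := h3 x' t' ht'
      simp only [hf] at this
      linarith)
  set τ := 2 * m * (t - t₀) + 2 * (1 / 2) * (t - c) with hτ
  -- Since `u` falls at rate at most `C`, a test function touching it from above cannot fall faster:
  -- compare the maximum with a slightly later time.
  have hτC : -C ≤ τ := by
    by_contra! h
    set e := min (t₀ + 1 - t) ((-C - τ) / (2 * (m + 1))) with he
    have hepos : 0 < e := lt_min (by linarith) (div_pos (by linarith) (by positivity))
    have e0 : e ≤ t₀ + 1 - t := min_le_left _ _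
    have e1 := h3 x (t + e) ⟨by linarith, by linarith⟩
    have e2 := hmono x t e ht0.le hepos.le
    have e3 : e * (2 * (m + 1)) ≤ -C - τ :=
      (le_div_iff₀ (by positivity)).1 (min_le_right _ _)
    simp only [hf] at e1
    have e4 : -C * e ≤ (τ + (m + 1 / 2) * e) * e := by rw [hτ]; linarith
    have e5 := le_of_mul_le_mul_right e4 hepos
    nlinarith
  -- Of the slope `R + 2`, one unit pays for the smoothing and one for the variational perturbation.
  -- Coercivity then gives `F ≥ C + 1`, incompatible with `τ ≥ -C`.
  have hgrad : R ≤ ‖((R + 2) / N x) • (x - y₀) + (2 * (1 / 2 : ℝ)) • (x - b)‖ := by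
    have e1 : R + 1 ≤ ‖((R + 2) / N x) • (x - y₀)‖ := by
      rw [norm_smul, Real.norm_of_nonneg (div_nonneg (by linarith) (hNpos x).le), div_mul_eq_mul_div,
        le_div_iff₀ (hNpos x)]
      have := mul_le_mul_of_nonneg_left (hNle x) (show 0 ≤ R + 1 by linarith)
      linarith
    have e2 : ‖(2 * (1 / 2 : ℝ)) • (x - b)‖ ≤ 1 := by
      norm_num
      linarith
    have e3 := norm_sub_le (((R + 2) / N x) • (x - y₀) + (2 * (1 / 2 : ℝ)) • (x - b))
      ((2 * (1 / 2 : ℝ)) • (x - b))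
    rw [add_sub_cancel_right] at e3
    linarith
  have := hR _ hgrad x
  linarith

end Comparison

/-! ### Compactness of equi-Lipschitz sequences -/

section Ascoli

variable {X : Type*} [PseudoMetricSpace X]

/-- A sequence of equi-Lipschitz functions that converges on a dense set converges everywhere, and
uniformly on totally bounded sets. -/
theorem exists_limit_of_tendsto_dense {K : NNReal} {f : ℕ → X → ℝ}
    (hf : ∀ n, LipschitzWith K (f n)) {D : Set X} (hD : Dense D)
    (hlim : ∀ x ∈ D, ∃ l, Tendsto (fun n => f n x) atTop (𝓝 l)) :
    ∃ g : X → ℝ, LipschitzWith K g ∧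
      ∀ s : Set X, TotallyBounded s → TendstoUniformlyOn f g atTop s := by
  have hpt : ∀ x, ∃ l, Tendsto (fun n => f n x) atTop (𝓝 l) := fun x => by
    refine cauchySeq_tendsto_of_complete (Metric.cauchySeq_iff'.2 fun ε hε => ?_)
    obtain ⟨y, hy, hxy⟩ := Metric.dense_iff.1 hD x (ε / (3 * (K + 1))) (by positivity)
    obtain ⟨l, hl⟩ := hlim y hxy
    obtain ⟨N, hN⟩ := Metric.cauchySeq_iff'.1 hl.cauchySeq (ε / 3) (by positivity)
    refine ⟨N, fun n hn => ?_⟩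
    have h3 : K * dist x y < ε / 3 := by
      rw [Metric.mem_ball, dist_comm, lt_div_iff₀ (by positivity)] at hy
      nlinarith [dist_nonneg (x := x) (y := y)]
    have h1 := (hf n).dist_le_mul x y
    have h2 := (hf N).dist_le_mul y x
    rw [dist_comm y x] at h2
    have h4 := dist_triangle4 (f n x) (f n y) (f N y) (f N x)
    linarith [hN n hn]
  choose g hg using hpt
  have hgK : LipschitzWith K g := LipschitzWith.of_dist_le_mul fun x y =>
    le_of_tendsto ((hg x).dist (hg y)) (Eventually.of_forall fun n => (hf n).dist_le_mul x y)
  refine ⟨g, hgK, fun s hs => Metric.tendstoUniformlyOn_iff.2 fun ε hε => ?_⟩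
  obtain ⟨t, ht, hst⟩ := Metric.totallyBounded_iff.1 hs (ε / (3 * (K + 1))) (by positivity)
  have hev : ∀ᶠ n in atTop, ∀ y ∈ t, dist (f n y) (g y) < ε / 3 :=
    (eventually_all_finite ht).2 fun y _ =>
      (Metric.tendsto_nhds.1 (hg y)) (ε / 3) (by positivity)
  filter_upwards [hev] with n hn x hx
  obtain ⟨y, hy, hxy⟩ := mem_iUnion₂.1 (hst hx)
  have h3 : K * dist x y < ε / 3 := by
    rw [Metric.mem_ball, lt_div_iff₀ (by positivity)] at hxy
    nlinarith [dist_nonneg (x := x) (y := y)]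
  have h1 := hgK.dist_le_mul x y
  have h2 := (hf n).dist_le_mul y x
  rw [dist_comm y x] at h2
  have h4 := dist_triangle4 (g x) (g y) (f n y) (f n x)
  rw [dist_comm (g y)] at h4
  linarith [hn y hy]

/-- The Arzelà–Ascoli theorem for equi-Lipschitz functions on a proper space. -/
theorem exists_subseq_tendstoUniformlyOn_bounded [ProperSpace X] [Nonempty X] {K : NNReal}
    {f : ℕ → X → ℝ} (hf : ∀ n, LipschitzWith K (f n)) (hb : ∀ x, ∃ B, ∀ n, |f n x| ≤ B) :
    ∃ (k : ℕ → ℕ) (g : X → ℝ), StrictMono k ∧ LipschitzWith K g ∧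
      ∀ s : Set X, Bornology.IsBounded s →
        TendstoUniformlyOn (fun n => f (k n)) g atTop s := by
  choose B hB using hb
  -- Sequential compactness of a countable product of intervals replaces the diagonal extraction.
  obtain ⟨l, -, k, hk, hl⟩ := (isCompact_univ_pi fun j : ℕ =>
    (isCompact_Icc : IsCompact (Icc (-B (TopologicalSpace.denseSeq X j))
      (B (TopologicalSpace.denseSeq X j))))).tendsto_subseq
    (x := fun n j => f n (TopologicalSpace.denseSeq X j)) (fun n j _ => abs_le.1 (hB _ n))
  obtain ⟨g, hg, hlim⟩ := exists_limit_of_tendsto_dense (fun n => hf (k n))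
    (TopologicalSpace.denseRange_denseSeq X) (by
      rintro _ ⟨j, rfl⟩
      exact ⟨l j, (tendsto_pi_nhds.1 hl) j⟩)
  exact ⟨k, g, hk, hg, fun s hs => hlim s
    (Metric.isCompact_of_isClosed_isBounded isClosed_closure hs.closure |>.totallyBounded.subset
      subset_closure)⟩

end Ascoli

/-! ### Lattice configurations and the mean -/

section Lattice

variable {d : ℕ}

theorem integral_apply_coord {f : Label d → EuclideanSpace ℝ (Fin d)} (hf : Integrable f)
    (k : Fin d) : (∫ i, f i) k = ∫ i, f i k :=
  ((EuclideanSpace.proj (𝕜 := ℝ) k).integral_comp_comm hf).symm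

theorem Config.integrable (x : Config d) : Integrable x volume :=
  (Lp.memLp x).integrable one_le_two

theorem volume_coord_le (k : Fin d) {m : ℝ} (h0 : 0 ≤ m) (h1 : m ≤ 1) :
    (volume : Measure (Label d)).real {i | (i k : ℝ) ≤ m} = m := by
  have hmp : MeasurePreserving (Function.eval k : Label d → unitInterval) volume volume :=
    measurePreserving_eval _ k
  have hset : {i : Label d | (i k : ℝ) ≤ m} = Function.eval k ⁻¹' Iic (⟨m, h0, h1⟩ : unitInterval) :=
    rfl
  rw [hset, measureReal_def, hmp.measure_preimage measurableSet_Iic.nullMeasurableSet,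
    unitInterval.volume_Iic, ENNReal.toReal_ofReal h0]

/-- Every configuration is at bounded distance from a lattice configuration of the same mean. -/
theorem exists_latticeConfig_near (x : Config d) :
    ∃ z ∈ latticeConfigs d, ∫ i, z i = ∫ i, x i ∧ ‖x - z‖ ≤ √d := by
  have hxm : ∀ k, Measurable fun i => x i k := fun k =>
    ((EuclideanSpace.proj (𝕜 := ℝ) k).continuous.comp_stronglyMeasurable
      (Lp.stronglyMeasurable x)).measurable
  -- Coordinate `k` is rounded up on a set `A k` of measure `m k` and down elsewhere, so the mean is
  -- preserved. The `k`-th coordinate of the label cuts out such a set, and each rounding error lies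
  -- in `[-1, 1]`.
  set m : Fin d → ℝ := fun k => ∫ i, Int.fract (x i k) with hm
  have hfi : ∀ k, Integrable (fun i => Int.fract (x i k)) volume := fun k =>
    (integrable_const (1 : ℝ)).mono' (hxm k).fract.aestronglyMeasurable
      (Eventually.of_forall fun i => by
        rw [Real.norm_of_nonneg (Int.fract_nonneg _)]; exact (Int.fract_lt_one _).le)
  have hm0 : ∀ k, 0 ≤ m k := fun k => integral_nonneg fun i => Int.fract_nonneg _
  have hm1 : ∀ k, m k ≤ 1 := fun k => by
    have := integral_mono (hfi k) (integrable_const (1 : ℝ))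
      (fun i => (Int.fract_lt_one (x i k)).le)
    simpa using this
  set A : Fin d → Set (Label d) := fun k => {i | (i k : ℝ) ≤ m k} with hA
  have hAm : ∀ k, MeasurableSet (A k) := fun k =>
    measurableSet_le (measurable_subtype_coe.comp (measurable_pi_apply k)) measurable_const
  set w : Label d → EuclideanSpace ℝ (Fin d) := fun i =>
    WithLp.toLp 2 fun k => Int.fract (x i k) - (A k).indicator 1 i with hw
  have hwm : Measurable w := by
    refine (WithLp.measurable_toLp 2 _).comp (measurable_pi_lambda _ fun k => ?_)
    exact (hxm k).fract.sub (measurable_one.indicator (hAm k))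
  have hwb : ∀ i, ‖w i‖ ≤ √d := fun i => by
    rw [EuclideanSpace.norm_eq]
    refine Real.sqrt_le_sqrt ?_
    have h1 : ∀ k ∈ Finset.univ, ‖w i k‖ ^ 2 ≤ (1 : ℝ) := fun k _ => by
      have h2 := Int.fract_nonneg (x i k)
      have h3 := Int.fract_lt_one (x i k)
      have h4 : |w i k| ≤ 1 := by
        simp only [hw, indicator_apply, Pi.one_apply]
        rw [abs_le]
        split_ifs <;> constructor <;> linarith
      exact pow_le_one₀ (norm_nonneg _) h4
    simpa using Finset.sum_le_sum h1
  have hwL : MemLp w 2 volume :=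
    MemLp.of_bound hwm.aestronglyMeasurable (√d) (Eventually.of_forall hwb)
  set W : Config d := hwL.toLp w with hW
  have hWw : W =ᵐ[volume] w := hwL.coeFn_toLp
  have hwint : ∫ i, w i = 0 := by
    ext k
    rw [integral_apply_coord (hwL.integrable one_le_two)]
    simp only [hw]
    have h1 : Integrable ((A k).indicator (1 : Label d → ℝ)) volume :=
      (integrable_const (1 : ℝ)).indicator (hAm k)
    rw [integral_sub (hfi k) h1, integral_indicator_one (hAm k),
      volume_coord_le k (hm0 k) (hm1 k)]
    simp [hm]
  have hsub : (x - W : Config d) =ᵐ[volume] fun i => x i - w i := by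
    filter_upwards [Lp.coeFn_sub x W, hWw] with i h1 h2
    rw [h1, Pi.sub_apply, h2]
  refine ⟨x - W, ?_, ?_, ?_⟩
  · filter_upwards [hsub] with i hi k
    rw [hi]
    simp only [hw, PiLp.sub_apply, indicator_apply, Pi.one_apply]
    split_ifs
    · exact ⟨⌊x i k⌋ + 1, by push_cast; linarith [Int.floor_add_fract (x i k)]⟩
    · exact ⟨⌊x i k⌋, by linarith [Int.floor_add_fract (x i k)]⟩
  · rw [integral_congr_ae hsub, integral_sub x.integrable (hwL.integrable one_le_two), hwint,
      sub_zero]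
  · rw [sub_sub_cancel]
    refine (Lp.norm_le_of_ae_bound (C := √d) (by positivity) ?_).trans ?_
    · filter_upwards [hWw] with i hi
      rw [hi]; exact hwb i
    · have h1 : measureUnivNNReal (volume : Measure (Label d)) = 1 := by
        simp [measureUnivNNReal]
      simp [h1]

theorem norm_integral_le_norm (x : Config d) : ‖∫ i, x i‖ ≤ ‖x‖ := by
  have h1 : ‖∫ i, x i‖ ≤ ∫ i, ‖x i‖ := norm_integral_le_integral_norm _
  have h2 : eLpNorm x 1 volume ≤ eLpNorm x 2 volume :=
    eLpNorm_le_eLpNorm_of_exponent_le one_le_two (Lp.memLp x).aestronglyMeasurable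
  rw [eLpNorm_one_eq_lintegral_enorm] at h2
  rw [Lp.norm_def]
  refine h1.trans ?_
  rw [integral_norm_eq_lintegral_enorm (Lp.memLp x).aestronglyMeasurable]
  exact ENNReal.toReal_mono (Lp.memLp x).eLpNorm_ne_top h2

theorem integral_config_sub (x y : Config d) :
    ∫ i, (x - y : Config d) i = (∫ i, x i) - ∫ i, y i := by
  rw [integral_congr_ae (Lp.coeFn_sub x y)]
  exact integral_sub x.integrable y.integrable

theorem integral_const_config (v : EuclideanSpace ℝ (Fin d)) :
    ∫ i, (Lp.const 2 (volume : Measure (Label d)) v : Config d) i = v := by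
  rw [integral_congr_ae (Lp.coeFn_const 2 volume v)]
  simp

theorem dist_integral_le (x y : Config d) : dist (∫ i, x i) (∫ i, y i) ≤ dist x y := by
  rw [dist_eq_norm, dist_eq_norm, ← integral_config_sub]
  exact norm_integral_le_norm _

theorem norm_const_config_sub (v v' : EuclideanSpace ℝ (Fin d)) :
    ‖(Lp.const 2 (volume : Measure (Label d)) v : Config d) - Lp.const 2 volume v'‖ ≤ ‖v - v'‖ := by
  rw [← map_sub]
  refine (Lp.norm_const_le _ _ _).trans ?_
  simp

end Lattice

/-! ### Translation invariance of the equation -/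

section Shift

variable {V : Type*} [NormedAddCommGroup V]

theorem BoundedInTime.shift {u : V → ℝ → ℝ} (hu : BoundedInTime u) (v : V) {h : ℝ} (hh : 0 ≤ h)
    (κ : ℝ) : BoundedInTime fun x t => u (x + v) (t + h) + κ where
  continuousOn := by
    refine ContinuousOn.add ?_ continuousOn_const
    exact hu.continuousOn.comp (f := fun q : V × ℝ => (q.1 + v, q.2 + h)) (by fun_prop)
      fun q hq => ⟨mem_univ _, add_nonneg hq.2 hh⟩
  bounded T := by
    obtain ⟨A, hA⟩ := hu.bounded (T + h)
    refine ⟨A + |κ|, fun x t ht htT => (abs_add_le _ _).trans ?_⟩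
    linarith [hA (x + v) (t + h) (by linarith) (by linarith)]

theorem BoundedInTime.neg {u : V → ℝ → ℝ} (hu : BoundedInTime u) :
    BoundedInTime fun x t => -u x t where
  continuousOn := hu.continuousOn.neg
  bounded T := by
    obtain ⟨A, hA⟩ := hu.bounded T
    exact ⟨A, fun x t h1 h2 => (abs_neg _).trans_le (hA x t h1 h2)⟩

variable [InnerProductSpace ℝ V] [CompleteSpace V]

/-- The equation involves neither `t` nor the value of `u`, so time shifts and constants are free.
Used with `h = 0` for periodicity and with `v = 0` for the time estimate. -/
theorem SeparatedSubsolution.shift {F : V → V → ℝ} {u : V → ℝ → ℝ}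
    (hu : SeparatedSubsolution F u) {v : V} (hF : ∀ x p, F (x + v) p = F x p) {h : ℝ}
    (hh : 0 ≤ h) (κ : ℝ) : SeparatedSubsolution F fun x t => u (x + v) (t + h) + κ := by
  intro a c ha hc x₀ t₀ ht₀ hmax
  have hg : gradient (fun x => a (x - v)) (x₀ + v) = gradient a x₀ := by
    unfold gradient
    simp only [sub_eq_add_neg]
    rw [fderiv_comp_add_right, add_neg_cancel_right]
  have hd : deriv (fun t => c (t - h)) (t₀ + h) = deriv c t₀ := by
    rw [deriv_comp_sub_const, add_sub_cancel_right]
  have key := hu (fun x => a (x - v)) (fun t => c (t - h))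
    (ha.comp (contDiff_id.sub contDiff_const)) (hc.comp (contDiff_id.sub contDiff_const))
    (x₀ + v) (t₀ + h) (by linarith) ?_
  · rwa [hg, hd, hF] at key
  · have h1 : ContinuousAt (fun q : V × ℝ => (q.1 - v, q.2 - h)) (x₀ + v, t₀ + h) := by fun_prop
    have h2 : Tendsto (fun q : V × ℝ => (q.1 - v, q.2 - h)) (𝓝 (x₀ + v, t₀ + h))
        (𝓝 (x₀, t₀)) := by
      simpa [ContinuousAt] using h1
    filter_upwards [h2.eventually hmax] with q hq
    simp only [sub_add_cancel] at hq
    simp only [add_sub_cancel_right]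
    linarith

end Shift

/-! ### Estimates uniform in the scale, and passage to the limit -/

variable {d : ℕ}

theorem IsViscositySubsolution.separated {F : Config d → Config d → ℝ} {u : Config d → ℝ → ℝ}
    (hu : IsViscositySubsolution F u) : SeparatedSubsolution F u := by
  intro a c ha hc x₀ t₀ ht₀ hmax
  have key := hu (fun x t => a x + c t)
    ((ha.comp contDiff_fst).add (hc.comp contDiff_snd)).contDiffOn x₀ t₀ ht₀ hmax
  have hg : gradient (fun x => a x + c t₀) x₀ = gradient a x₀ := by
    unfold gradient
    rw [fderiv_add_const]
  rwa [deriv_const_add, hg] at key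

/-- Reflection lets the subsolution lemmas serve supersolutions. The reflected Hamiltonian is not
coercive, which is why comparison draws its momentum bound from `u` alone. -/
theorem IsViscositySupersolution.separated_neg {F : Config d → Config d → ℝ}
    {u : Config d → ℝ → ℝ} (hu : IsViscositySupersolution F u) :
    SeparatedSubsolution (fun x p => -F x (-p)) fun x t => -u x t := by
  intro a c ha hc x₀ t₀ ht₀ hmax
  have key := hu (fun x t => -a x - c t)
    ((ha.comp contDiff_fst).neg.sub (hc.comp contDiff_snd)).contDiffOn x₀ t₀ ht₀ (by
      filter_upwards [hmax] with q hq
      linarith)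
  have hg : gradient (fun x => -a x - c t₀) x₀ = -gradient a x₀ := by
    unfold gradient
    rw [fderiv_sub_const, fderiv_fun_neg, map_neg]
  have hd : deriv (fun t => -a x₀ - c t) t₀ = -deriv c t₀ := deriv_const_sub _
  rw [hg, hd] at key
  linarith

variable {H : Config d → Config d → ℝ} {u₀ : Config d → ℝ}

/-- Modulo `Λ` every `x` lies in the ball of radius `√d`, and a Lipschitz function is bounded on
bounded sets. -/
theorem IsAdmissibleHamiltonian.bounded (hH : IsAdmissibleHamiltonian H) (R : ℝ) :
    ∃ C : ℝ, 0 ≤ C ∧ ∀ x p, ‖p‖ ≤ R → |H x p| ≤ C := by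
  obtain ⟨K, hK⟩ := hH.lipschitz (|R| + 1) (by positivity)
  refine ⟨|H 0 0| + K * (√d + |R|), by positivity, fun x p hp => ?_⟩
  obtain ⟨z, hz, -, hxz⟩ := exists_latticeConfig_near x
  have hpR := hp.trans (le_abs_self R)
  have h1 := hK.dist_le_mul (x - z, p) ⟨mem_univ _, mem_ball_zero_iff.2 (by linarith)⟩
    (0, 0) ⟨mem_univ _, mem_ball_zero_iff.2 (by rw [norm_zero]; positivity)⟩
  have h2 : H (x - z) p = H x p := by
    rw [← hH.periodic (x - z) p z hz, sub_add_cancel]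
  have h3 : dist (x - z, p) ((0 : Config d), (0 : Config d)) ≤ √d + |R| := by
    rw [Prod.dist_eq, dist_zero_right, dist_zero_right]
    exact max_le (hxz.trans (by linarith [abs_nonneg R])) (hpR.trans (by linarith [Real.sqrt_nonneg d]))
  have h4 := h1.trans (mul_le_mul_of_nonneg_left h3 K.coe_nonneg)
  rw [Real.dist_eq, h2] at h4
  have h5 := abs_sub_abs_le_abs_sub (H x p) (H 0 0)
  linarith

/-- The constant blows up as `ε → 0`, harmlessly: it enters only the comparison principle at fixed
`ε`. -/
theorem IsAdmissibleHamiltonian.lipschitz_scaled (hH : IsAdmissibleHamiltonian H) {ε : ℝ}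
    (hε : 0 < ε) (R : ℝ) : ∃ K : ℝ, 0 ≤ K ∧ ∀ x y p q : Config d, ‖p‖ < R → ‖q‖ < R →
      H (ε⁻¹ • y) q - H (ε⁻¹ • x) p ≤ K * (‖x - y‖ + ‖p - q‖) := by
  obtain ⟨K, hK⟩ := hH.lipschitz (|R| + 1) (by positivity)
  refine ⟨K * (ε⁻¹ + 1), by positivity, fun x y p q hp hq => ?_⟩
  have hR := le_abs_self R
  have h1 := hK.dist_le_mul (ε⁻¹ • y, q) ⟨mem_univ _, mem_ball_zero_iff.2 (by linarith)⟩
    (ε⁻¹ • x, p) ⟨mem_univ _, mem_ball_zero_iff.2 (by linarith)⟩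
  have hεi : 0 < ε⁻¹ := inv_pos.2 hε
  have h2 : dist (ε⁻¹ • y, q) (ε⁻¹ • x, p) ≤ (ε⁻¹ + 1) * (‖x - y‖ + ‖p - q‖) := by
    rw [Prod.dist_eq, dist_eq_norm, dist_eq_norm, ← smul_sub, norm_smul,
      Real.norm_of_nonneg hεi.le, norm_sub_rev y x, norm_sub_rev q p]
    have e1 := norm_nonneg (x - y)
    have e2 := norm_nonneg (p - q)
    have e3 := mul_nonneg hεi.le e1
    have e4 := mul_nonneg hεi.le e2
    exact max_le (by linarith) (by linarith)
  have h3 := h1.trans (mul_le_mul_of_nonneg_left h2 K.coe_nonneg)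
  rw [Real.dist_eq, ← mul_assoc] at h3
  exact (le_abs_self _).trans h3

theorem IsAdmissibleInitialDatum.lipschitz (hu₀ : IsAdmissibleInitialDatum u₀) {A : ℝ}
    (hA : ∀ x, ‖fderiv ℝ u₀ x‖ ≤ A) (x y : Config d) : |u₀ x - u₀ y| ≤ A * ‖x - y‖ :=
  convex_univ.norm_image_sub_le_of_norm_fderiv_le
    (fun z _ => hu₀.contDiff.differentiable one_ne_zero z) (fun z _ => hA z) (mem_univ y)
    (mem_univ x)

theorem IsViscositySolution.boundedInTime {ε : ℝ} {u : Config d → ℝ → ℝ}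
    (hu : IsViscositySolution H u₀ ε u) : BoundedInTime u :=
  ⟨hu.continuousOn, hu.bounded⟩

/-- The speed at which solutions leave the initial datum is bounded uniformly in `ε`. -/
theorem exists_initial_speed (hH : IsAdmissibleHamiltonian H)
    (hu₀ : IsAdmissibleInitialDatum u₀) :
    ∃ C : ℝ, 0 ≤ C ∧ ∀ ε : ℝ, ∀ u : Config d → ℝ → ℝ, IsViscositySolution H u₀ ε u →
      ∀ x t, 0 ≤ t → u x t ≤ u₀ x + C * t ∧ -u x t ≤ -u₀ x + C * t := by
  obtain ⟨A, hA⟩ := hu₀.bounded_fderiv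
  obtain ⟨B, hB⟩ := hu₀.bounded
  obtain ⟨C, hC, hCH⟩ := hH.bounded (A + 1)
  have hgrad : ∀ x, ‖gradient u₀ x‖ ≤ A := fun x => by
    unfold gradient
    rw [LinearIsometryEquiv.norm_map]
    exact hA x
  refine ⟨C, hC, fun ε u hu x t ht => ⟨?_, ?_⟩⟩
  · exact hu.subsolution.separated.le_initial_add hu.boundedInTime hu₀.contDiff hB hgrad
      (fun x p hp => (abs_le.1 (hCH _ p hp)).1) (fun x => (hu.initial x).le) x ht
  · refine hu.supersolution.separated_neg.le_initial_add hu.boundedInTime.neg hu₀.contDiff.neg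
      (A := A) (B := B) (fun x => (abs_neg _).trans_le (hB x)) (fun x => ?_)
      (fun x p hp => neg_le_neg (abs_le.1 (hCH _ (-p) ((norm_neg p).trans_le hp))).2)
      (fun x => (neg_le_neg (hu.initial x).ge)) x ht
    have : gradient (fun x => -u₀ x) x = -gradient u₀ x := by
      unfold gradient
      rw [fderiv_fun_neg, map_neg]
    rw [this, norm_neg]
    exact hgrad x

/-- Comparison for the rescaled equation between functions with linear growth in time away from the
initial datum. -/
theorem comparison_scaled (hH : IsAdmissibleHamiltonian H) (hu₀ : IsAdmissibleInitialDatum u₀)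
    {ε : ℝ} (hε : 0 < ε) {u w : Config d → ℝ → ℝ}
    (hu : SeparatedSubsolution (fun x p => H (ε⁻¹ • x) p) u)
    (hw : SeparatedSubsolution (fun x p => -H (ε⁻¹ • x) (-p)) w) (hub : BoundedInTime u)
    (hwb : BoundedInTime w) {C : ℝ} (hC : 0 ≤ C) (hu0 : ∀ x t, 0 ≤ t → u x t ≤ u₀ x + C * t)
    (hw0 : ∀ x t, 0 ≤ t → w x t ≤ -u₀ x + C * t) (x : Config d) {t : ℝ} (ht : 0 ≤ t) :
    u x t + w x t ≤ 0 := by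
  obtain ⟨A, hA⟩ := hu₀.bounded_fderiv
  refine hu.comparison (F := fun x p => H (ε⁻¹ • x) p) (fun A => ?_) (hH.lipschitz_scaled hε) hw
    hub hwb ((norm_nonneg _).trans (hA 0)) hC
    (fun x y => (le_abs_self _).trans (hu₀.lipschitz hA x y)) hu0 hw0 x ht
  obtain ⟨R, hR⟩ := hH.coercive A
  exact ⟨R, fun p hp x => hR p hp _⟩

/-- Solutions are Lipschitz in time and space and locally bounded, uniformly in `ε`. -/
theorem exists_uniform_estimates (hH : IsAdmissibleHamiltonian H)
    (hu₀ : IsAdmissibleInitialDatum u₀) :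
    ∃ B C L : ℝ, 0 ≤ C ∧ 0 ≤ L ∧ ∀ ε : ℝ, 0 < ε → ∀ u : Config d → ℝ → ℝ,
      IsViscositySolution H u₀ ε u →
        (∀ x t, 0 ≤ t → |u x t| ≤ B + C * t) ∧
        (∀ x t h, 0 ≤ t → 0 ≤ h → |u x (t + h) - u x t| ≤ C * h) ∧
        ∀ x y t, 0 ≤ t → |u x t - u y t| ≤ L * ‖x - y‖ := by
  obtain ⟨A, hA⟩ := hu₀.bounded_fderiv
  obtain ⟨B, hB⟩ := hu₀.bounded
  obtain ⟨C, hC, hspeed⟩ := exists_initial_speed hH hu₀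
  obtain ⟨R, hR⟩ := hH.coercive (C + 1)
  have hA0 : 0 ≤ A := (norm_nonneg _).trans (hA 0)
  -- The summand `A` covers `t = 0`, where the solution is `u₀`; coercivity yields `|R| + 2` for
  -- positive times.
  refine ⟨B, C, |R| + 2 + A, hC, by positivity, fun ε hε u hu => ?_⟩
  have hb := hu.boundedInTime
  have hsub := hu.subsolution.separated
  have hsup := hu.supersolution.separated_neg
  have hsp := hspeed ε u hu
  have htime : ∀ x t h, 0 ≤ t → 0 ≤ h → |u x (t + h) - u x t| ≤ C * h := fun x t h ht hh => by
    -- Lowering the time shift by `Ch` puts it under the barrier `u₀ + Cs` again, so comparison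
    -- applies and gives one side; shifting `-u` gives the other.
    have h1 := comparison_scaled hH hu₀ hε (hsub.shift (v := 0) (by simp) hh (-(C * h))) hsup
      (hb.shift 0 hh _) hb.neg hC
      (fun x s hs => by
        have := (hsp x (s + h) (by linarith)).1
        simp only [add_zero]
        linarith)
      (fun x s hs => (hsp x s hs).2) x ht
    have h2 := comparison_scaled hH hu₀ hε hsub (hsup.shift (v := 0) (by simp) hh (-(C * h)))
      hb (hb.neg.shift 0 hh _) hC (fun x s hs => (hsp x s hs).1)
      (fun x s hs => by
        have := (hsp x (s + h) (by linarith)).2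
        simp only [add_zero]
        linarith) x ht
    simp only [add_zero] at h1 h2
    exact abs_le.2 ⟨by linarith, by linarith⟩
  refine ⟨fun x t ht => ?_, htime, fun x y t ht => ?_⟩
  · have h1 := hsp x t ht
    have h2 := abs_le.1 (hB x)
    exact abs_le.2 ⟨by linarith, by linarith⟩
  · have hn := norm_nonneg (x - y)
    rcases ht.eq_or_lt with rfl | ht
    · rw [hu.initial, hu.initial]
      have := hu₀.lipschitz hA x y
      have := mul_nonneg (show 0 ≤ |R| + 2 by positivity) hn
      linarith
    · have hlip : ∀ x y, u x t - u y t ≤ (|R| + 2) * ‖x - y‖ := fun x y =>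
        hsub.lipschitz_space hb (C := C) (abs_nonneg R)
          (fun p hp x => hR p ((le_abs_self R).trans hp) _)
          (fun x t h ht hh => by linarith [(abs_le.1 (htime x t h ht hh)).1]) x y ht
      have h1 := hlip x y
      have h2 := hlip y x
      rw [norm_sub_rev y x] at h2
      have h3 := mul_nonneg hA0 hn
      exact abs_le.2 ⟨by linarith, by linarith⟩

/-- Translation by `εz` preserves the equation by periodicity of `H`, and the initial datum because
`z` has mean zero. Comparison in both directions identifies the two solutions. -/
theorem IsViscositySolution.periodic (hH : IsAdmissibleHamiltonian H)
    (hu₀ : IsAdmissibleInitialDatum u₀) {ε : ℝ} (hε : 0 < ε) {u : Config d → ℝ → ℝ}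
    (hu : IsViscositySolution H u₀ ε u) {z : Config d} (hz : z ∈ latticeConfigs d)
    (hz0 : ∫ i, z i = 0) (x : Config d) {t : ℝ} (ht : 0 ≤ t) : u (x + ε • z) t = u x t := by
  obtain ⟨C, hC, hspeed⟩ := exists_initial_speed hH hu₀
  have hsp := hspeed ε u hu
  have hper : ∀ x p : Config d, H (ε⁻¹ • (x + ε • z)) p = H (ε⁻¹ • x) p := fun x p => by
    rw [smul_add, inv_smul_smul₀ hε.ne', hH.periodic _ _ z hz]
  have hinit : ∀ x, u₀ (x + ε • z) = u₀ x := fun x => by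
    have h1 : x + ε • z = x - (-ε) • z := by rw [neg_smul, sub_neg_eq_add]
    have h2 : meanConfig (x + ε • z) = meanConfig x := by
      unfold meanConfig
      congr 1
      rw [h1, integral_config_sub, integral_congr_ae (Lp.coeFn_smul (-ε) z)]
      simp only [Pi.smul_apply]
      rw [integral_smul, hz0, smul_zero, sub_zero]
    rw [hu₀.mean, h2, ← hu₀.mean]
  have hb := hu.boundedInTime
  have hsub := hu.subsolution.separated
  have hsup := hu.supersolution.separated_neg
  have h1 := comparison_scaled hH hu₀ hε (hsub.shift (v := ε • z) hper le_rfl 0) hsup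
    (hb.shift _ le_rfl _) hb.neg hC
    (fun x s hs => by
      have := (hsp (x + ε • z) s hs).1
      rw [hinit] at this
      simpa using this)
    (fun x s hs => (hsp x s hs).2) x ht
  have h2 := comparison_scaled hH hu₀ hε hsub
    (hsup.shift (v := ε • z) (fun x p => congrArg _ (hper x (-p))) le_rfl 0)
    hb (hb.neg.shift _ le_rfl _) hC (fun x s hs => (hsp x s hs).1)
    (fun x s hs => by
      have := (hsp (x + ε • z) s hs).2
      rw [hinit] at this
      simpa using this) x ht
  simp only [add_zero] at h1 h2
  linarith

/-- A mean-zero lattice vector `z` lies within `√d` of `(x - Mx)/ε`. Periodicity replaces `x` by `x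
- εz`, at distance at most `ε√d` from `Mx`, and the uniform Lipschitz bound finishes. Adding `1`
only makes the constant positive. -/
theorem exists_mean_oscillation_bound (hH : IsAdmissibleHamiltonian H)
    (hu₀ : IsAdmissibleInitialDatum u₀) :
    ∃ C : ℝ, 0 < C ∧ ∀ ε : ℝ, 0 < ε → ∀ u : Config d → ℝ → ℝ, IsViscositySolution H u₀ ε u →
      ∀ (x : Config d) (t : ℝ), 0 ≤ t → |u x t - u (meanConfig x) t| ≤ C * ε := by
  obtain ⟨B, C, L, hC, hL, hest⟩ := exists_uniform_estimates hH hu₀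
  refine ⟨L * √d + 1, by positivity, fun ε hε u hu x t ht => ?_⟩
  obtain ⟨z, hz, hzi, hzd⟩ := exists_latticeConfig_near (ε⁻¹ • (x - meanConfig x))
  have hz0 : ∫ i, z i = 0 := by
    rw [hzi, integral_congr_ae (Lp.coeFn_smul ε⁻¹ (x - meanConfig x))]
    simp only [Pi.smul_apply]
    rw [integral_smul, integral_config_sub]
    unfold meanConfig
    rw [integral_const_config, sub_self, smul_zero]
  have h1 := hu.periodic hH hu₀ hε hz hz0 (x - ε • z) ht
  rw [sub_add_cancel] at h1
  have h2 := (hest ε hε u hu).2.2 (x - ε • z) (meanConfig x) t ht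
  have h3 : x - ε • z - meanConfig x = ε • (ε⁻¹ • (x - meanConfig x) - z) := by
    rw [smul_sub, smul_inv_smul₀ hε.ne']
    abel
  rw [h3, norm_smul, Real.norm_of_nonneg hε.le, ← h1] at h2
  have h4 := mul_le_mul_of_nonneg_left hzd (mul_nonneg hL hε.le)
  linarith

theorem exists_subseq_limit (hH : IsAdmissibleHamiltonian H) (hu₀ : IsAdmissibleInitialDatum u₀)
    {U : ℝ → Config d → ℝ → ℝ} (hU : ∀ ε : ℝ, 0 < ε → IsViscositySolution H u₀ ε (U ε))
    {ε : ℕ → ℝ} (hε : ∀ n, 0 < ε n) (hε0 : Tendsto ε atTop (𝓝 0)) :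
    ∃ (k : ℕ → ℕ) (u : Config d → ℝ → ℝ),
      StrictMono k ∧
      ContinuousOn (fun q : Config d × ℝ => u q.1 q.2) (univ ×ˢ Ici 0) ∧
      (∀ (x : Config d) (t : ℝ), 0 ≤ t → u x t = u (meanConfig x) t) ∧
      ∀ B : Set (Config d × ℝ), B ⊆ univ ×ˢ Ici 0 → Bornology.IsBounded B →
        TendstoUniformlyOn (fun (n : ℕ) (q : Config d × ℝ) => U (ε (k n)) q.1 q.2)
          (fun q : Config d × ℝ => u q.1 q.2) atTop B := by
  obtain ⟨B, C, L, hC, hL, hest⟩ := exists_uniform_estimates hH hu₀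
  obtain ⟨C', hC', hosc⟩ := exists_mean_oscillation_bound hH hu₀
  -- Restriction to constant configurations gives a proper domain; freezing negative times at `0`
  -- keeps the functions Lipschitz on all of it.
  let f : ℕ → EuclideanSpace ℝ (Fin d) × ℝ → ℝ := fun n q =>
    U (ε n) (Lp.const 2 volume q.1) (max q.2 0)
  have htime : ∀ n x t s, 0 ≤ t → 0 ≤ s → |U (ε n) x t - U (ε n) x s| ≤ C * |t - s| :=
    fun n x t s ht hs => by
      have key := (hest _ (hε n) _ (hU _ (hε n))).2.1
      rcases le_total s t with h | h
      · have := key x s (t - s) hs (sub_nonneg.2 h)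
        rwa [add_sub_cancel, ← abs_of_nonneg (sub_nonneg.2 h)] at this
      · have := key x t (s - t) ht (sub_nonneg.2 h)
        rwa [add_sub_cancel, ← abs_of_nonneg (sub_nonneg.2 h), abs_sub_comm,
          abs_sub_comm s t] at this
  have hf : ∀ n, LipschitzWith (L + C).toNNReal (f n) := fun n =>
    LipschitzWith.of_dist_le_mul fun q q' => by
      rw [Real.coe_toNNReal _ (by positivity), Real.dist_eq, add_mul]
      have h1 := (hest _ (hε n) _ (hU _ (hε n))).2.2 (Lp.const 2 volume q.1)
        (Lp.const 2 volume q'.1) (max q.2 0) (le_max_right _ _)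
      have h2 := htime n (Lp.const 2 volume q'.1) (max q.2 0) (max q'.2 0) (le_max_right _ _)
        (le_max_right _ _)
      have h3 : ‖q.1 - q'.1‖ ≤ dist q q' := by
        rw [← dist_eq_norm, Prod.dist_eq]; exact le_max_left _ _
      have h4 : |max q.2 0 - max q'.2 0| ≤ dist q q' := by
        refine (abs_max_sub_max_le_abs _ _ _).trans ?_
        rw [← Real.dist_eq, Prod.dist_eq]; exact le_max_right _ _
      have h5 := mul_le_mul_of_nonneg_left ((norm_const_config_sub q.1 q'.1).trans h3) hL
      have h6 := mul_le_mul_of_nonneg_left h4 hC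
      have h7 := abs_sub_le (f n q) (U (ε n) (Lp.const 2 volume q'.1) (max q.2 0)) (f n q')
      exact h7.trans (add_le_add (h1.trans h5) (h2.trans h6))
  obtain ⟨k, g, hk, hg, hlim⟩ := exists_subseq_tendstoUniformlyOn_bounded hf fun q =>
    ⟨B + C * max q.2 0, fun n => (hest _ (hε n) _ (hU _ (hε n))).1 _ _ (le_max_right _ _)⟩
  let P : Config d × ℝ → EuclideanSpace ℝ (Fin d) × ℝ := fun q => (∫ i, q.1 i, q.2)
  have hP : LipschitzWith 1 P := LipschitzWith.of_dist_le_mul fun q q' => by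
    rw [NNReal.coe_one, one_mul, Prod.dist_eq, Prod.dist_eq]
    exact max_le_max (dist_integral_le _ _) le_rfl
  refine ⟨k, fun x t => g (P (x, t)), hk, (hg.continuous.comp hP.continuous).continuousOn,
    fun x t _ => ?_, fun S hS hSb => Metric.tendstoUniformlyOn_iff.2 fun δ hδ => ?_⟩
  · simp only [P, meanConfig, integral_const_config]
  · have h1 := Metric.tendstoUniformlyOn_iff.1 (hlim _ (hP.isBounded_image hSb)) (δ / 2)
      (half_pos hδ)
    have h2 : Tendsto (fun n => C' * ε (k n)) atTop (𝓝 0) := by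
      simpa using (hε0.comp hk.tendsto_atTop).const_mul C'
    filter_upwards [h1, h2.eventually (gt_mem_nhds (half_pos hδ))] with n hn1 hn2 q hq
    have h3 := hn1 (P q) ⟨q, hq, rfl⟩
    have h4 := hosc _ (hε (k n)) _ (hU _ (hε (k n))) q.1 q.2 (hS hq).2
    have h5 : f (k n) (P q) = U (ε (k n)) (meanConfig q.1) q.2 := by
      simp only [f, P, meanConfig, max_eq_left (show (0 : ℝ) ≤ q.2 from (hS hq).2)]
    rw [h5] at h3
    rw [← Real.dist_eq, dist_comm] at h4
    exact (dist_triangle _ _ _).trans_lt (by linarith)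

end HJHom

theorem proposition2p6 (d : ℕ) (H : HJHom.Config d → HJHom.Config d → ℝ)
    (u₀ : HJHom.Config d → ℝ)
    (hH : HJHom.IsAdmissibleHamiltonian H) (hu₀ : HJHom.IsAdmissibleInitialDatum u₀) :
    (∀ ε : ℝ, 0 < ε → ∀ u : HJHom.Config d → ℝ → ℝ, HJHom.IsViscositySolution H u₀ ε u →
      ∀ z ∈ HJHom.latticeConfigs d ∩ HJHom.meanZero d, ∀ (x : HJHom.Config d) (t : ℝ), 0 ≤ t →
        u (x + ε • z) t = u x t) ∧
    (∃ C : ℝ, 0 < C ∧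
      ∀ ε : ℝ, 0 < ε → ∀ u : HJHom.Config d → ℝ → ℝ, HJHom.IsViscositySolution H u₀ ε u →
        ∀ (x : HJHom.Config d) (t : ℝ), 0 ≤ t →
          |u x t - u (HJHom.meanConfig x) t| ≤ C * ε) ∧
    (∀ U : ℝ → HJHom.Config d → ℝ → ℝ,
      (∀ ε : ℝ, 0 < ε → HJHom.IsViscositySolution H u₀ ε (U ε)) →
      ∀ ε : ℕ → ℝ, (∀ n, 0 < ε n) → Tendsto ε atTop (𝓝 0) →
        ∃ (k : ℕ → ℕ) (u : HJHom.Config d → ℝ → ℝ),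
          StrictMono k ∧
          ContinuousOn (fun q : HJHom.Config d × ℝ => u q.1 q.2) (univ ×ˢ Ici 0) ∧
          (∀ (x : HJHom.Config d) (t : ℝ), 0 ≤ t → u x t = u (HJHom.meanConfig x) t) ∧
          ∀ B : Set (HJHom.Config d × ℝ), B ⊆ univ ×ˢ Ici 0 → Bornology.IsBounded B →
            TendstoUniformlyOn (fun (n : ℕ) (q : HJHom.Config d × ℝ) => U (ε (k n)) q.1 q.2)
              (fun q : HJHom.Config d × ℝ => u q.1 q.2) atTop B) :=
  ⟨fun _ hε _ hu _ hz x _ ht => hu.periodic hH hu₀ hε hz.1 hz.2 x ht,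
    HJHom.exists_mean_oscillation_bound hH hu₀,
    fun _ hU _ hε hε0 => HJHom.exists_subseq_limit hH hu₀ hU hε hε0⟩
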